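/- Let $\Omega\subset\mathbb R^d$ be an open ball of radius $R>0$, let $\Delta$ be the Dirichlet Laplacian of $\Omega$ on $L^2(\Omega)$, and let $$H(t)=\frac1{|\Omega|}\int_\Omega \big(e^{t\Delta}1\big)(\mathbf r)\,d\mathbf r\quad(t>0),\qquad \tilde H^{(d)}(s)=\int_0^\infty e^{-s^2t}H(t)\,dt\quad(s>0)$$ be the normalized heat content of $\Omega$ and its Laplace transform. We say that $\tilde H^{(d)}$ has the Weyl series $\sum_{n\ge2}c_n s^{-n}$ if $\tilde H^{(d)}(s)-\sum_{n=2}^N c_ns^{-n}=o(s^{-N})$ as $s\to+\infty$ for every $N\ge 2$. A function of $s$ is called exponentially small if it is $O(e^{-\kappa s})$ as $s\to+\infty$ for some $\kappa>0$. Write $u=Rs$. For $d=1,3,5$ the integral defining $\tilde H^{(d)}(s)$ converges absolutely for all $s>0$, and the following holds. 1. For $d=1$, $$\tilde H^{(1)}(s)=\frac1{s^2}\Big(1-\frac1u\Big)$$ up to an exponentially small term. Consequently $\tilde H^{(1)}$ has a Weyl series, with uniquely determined coefficients: $c_2=1$, $c_3=-1/R$ and $c_n=0$ for all $n>3$. 2.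 For $d=3$, $$\tilde H^{(3)}(s)=\frac1{s^2}\Big(1-\frac3u+\frac3{u^2}\Big)$$ up to an exponentially small term. Consequently $\tilde H^{(3)}$ has a Weyl series, with uniquely determined coefficients: $c_2=1$, $c_3=-3/R$, $c_4=3/R^2$ and $c_n=0$ for all $n>4$. 3. For $d=5$, $$\tilde H^{(5)}(s)=\frac1{s^2}\,\frac{1-6u^{-1}+15u^{-2}-15u^{-3}}{1-u^{-1}}$$ up to an exponentially small term, where for $u>1$ $$\frac{1-6u^{-1}+15u^{-2}-15u^{-3}}{1-u^{-1}}=1-\frac5u+\frac{10}{u^2}-5\sum_{k=3}^\infty\frac1{u^k}$$ with a convergent series on the right. Consequently $\tilde H^{(5)}$ has a Weyl series, with uniquely determined coefficients: $c_2=1$, $c_3=-5/R$, $c_4=10/R^2$ and $c_n=-5/R^{n-2}$ for all $n\ge5$. -/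

import Mathlib

open MeasureTheory Filter Asymptotics
open scoped ContDiff

noncomputable section

namespace HeatContent

/-- The complex Hilbert space `L²(Ω)` with respect to Lebesgue measure. -/
abbrev L2 {d : ℕ} (Ω : Set (EuclideanSpace ℝ (Fin d))) : Type :=
  Lp ℂ 2 (volume.restrict Ω)

/-- The Hilbert space `L²(Ω) ⊕ L²(Ω)^d` of pairs (function, vector field); the inner product of
two pairs `(u, ∇u)`, `(v, ∇v)` is the `H¹` inner product of `u` and `v`. -/
abbrev FieldSpace {d : ℕ} (Ω : Set (EuclideanSpace ℝ (Fin d))) : Type :=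
  WithLp 2 (L2 Ω × PiLp 2 (fun _ : Fin d => L2 Ω))

/-- The pairs `(φ, ∇φ)` in which `φ` is a smooth function with compact support inside `Ω`. -/
def testPairs {d : ℕ} (Ω : Set (EuclideanSpace ℝ (Fin d))) : Set (FieldSpace Ω) :=
  {p | ∃ φ : EuclideanSpace ℝ (Fin d) → ℂ,
    ContDiff ℝ ∞ φ ∧ HasCompactSupport φ ∧ tsupport φ ⊆ Ω ∧
    p.fst =ᵐ[volume.restrict Ω] φ ∧
    ∀ i : Fin d, p.snd i =ᵐ[volume.restrict Ω]
      fun x => fderiv ℝ φ x (EuclideanSpace.single i 1)}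

/-- The Sobolev space `H¹₀(Ω)`: the closure of the test functions in the `H¹` norm.  An element is
stored as the pair of a function and its weak gradient. -/
def H10 {d : ℕ} (Ω : Set (EuclideanSpace ℝ (Fin d))) : Submodule ℂ (FieldSpace Ω) :=
  (Submodule.span ℂ (testPairs Ω)).topologicalClosure

instance {d : ℕ} (Ω : Set (EuclideanSpace ℝ (Fin d))) : CompleteSpace (H10 Ω) :=
  inferInstanceAs (CompleteSpace (Submodule.span ℂ (testPairs Ω)).topologicalClosure)

/-- The inclusion `H¹₀(Ω) → L²(Ω)`. -/
def embed {d : ℕ} (Ω : Set (EuclideanSpace ℝ (Fin d))) : H10 Ω →L[ℂ] L2 Ω :=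
  (WithLp.fstL 2 ℂ (L2 Ω) (PiLp 2 (fun _ : Fin d => L2 Ω))).comp (H10 Ω).subtypeL

/-- For a bounded operator `J : V → H` of Hilbert spaces, the operator `J J†` of `H`. -/
def mulAdjoint {V H : Type*} [NormedAddCommGroup V] [InnerProductSpace ℂ V] [CompleteSpace V]
    [NormedAddCommGroup H] [InnerProductSpace ℂ H] [CompleteSpace H] (J : V →L[ℂ] H) : H →L[ℂ] H :=
  J.comp (ContinuousLinearMap.adjoint J)

/-- The resolvent `(1 - Δ)⁻¹` of the Dirichlet Laplacian `Δ` of `Ω` on `L²(Ω)`.  By the definition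
of the adjoint, `u = embed† f` is the element of `H¹₀(Ω)` with
`⟨u, v⟩ + ⟨∇u, ∇v⟩ = ⟨f, v⟩` for all `v ∈ H¹₀(Ω)`, that is, the weak solution of `u - Δu = f` in `Ω`,
`u = 0` on `∂Ω`. -/
def dirichletResolvent {d : ℕ} (Ω : Set (EuclideanSpace ℝ (Fin d))) : L2 Ω →L[ℂ] L2 Ω :=
  mulAdjoint (V := H10 Ω) (H := L2 Ω) (embed Ω)

/-- If `T = (1 + A)⁻¹` is the resolvent of a self-adjoint operator `A ≥ 0` of a Hilbert space, then
this is the operator `exp (-t A)`, for `t > 0`, by the continuous functional calculus of `T`.  An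
eigenvalue `lam` of `A` is the eigenvalue `x = 1 / (1 + lam)` of `T`, so that
`exp (-t * lam) = exp (-t * (1 / x - 1))`; the value at `x = 0` is the limit, corresponding to
`lam = ∞`. -/
def semigroupOfResolvent {H : Type*} [NormedAddCommGroup H] [InnerProductSpace ℂ H]
    [CompleteSpace H] (T : H →L[ℂ] H) (t : ℝ) : H →L[ℂ] H :=
  cfc (fun x : ℝ => if x ≤ 0 then 0 else Real.exp (-t * (1 / x - 1))) T

/-- The Dirichlet heat operator `exp (t Δ)` on `L²(Ω)`, for `t > 0`. -/
def heatOperator {d : ℕ} (Ω : Set (EuclideanSpace ℝ (Fin d))) (t : ℝ) : L2 Ω →L[ℂ] L2 Ω :=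
  semigroupOfResolvent (H := L2 Ω) (dirichletResolvent Ω) t

/-- The local heat content `r ↦ H(t; r)`: the temperature at time `t > 0` in `Ω`, with
`∂Ω` held at temperature `0` and initial temperature `1` in `Ω`. -/
def localHeatContent {d : ℕ} (Ω : Set (EuclideanSpace ℝ (Fin d)))
    [IsFiniteMeasure (volume.restrict Ω)] (t : ℝ) : L2 Ω :=
  heatOperator Ω t (Lp.const 2 (volume.restrict Ω) (1 : ℂ))

/-- The normalized heat content `H(t) = |Ω|⁻¹ ∫_Ω H(t; r) dr`. -/
def heatContent {d : ℕ} (Ω : Set (EuclideanSpace ℝ (Fin d)))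
    [IsFiniteMeasure (volume.restrict Ω)] (t : ℝ) : ℝ :=
  (1 / volume.real Ω) * ∫ r in Ω, (localHeatContent Ω t r).re

/-- A ball has finite measure. -/
instance {d : ℕ} (a : EuclideanSpace ℝ (Fin d)) (R : ℝ) :
    IsFiniteMeasure (volume.restrict (Metric.ball a R)) :=
  isFiniteMeasure_restrict.mpr measure_ball_lt_top.ne

/-- The Laplace transform `∫_0^∞ exp (-s² t) H(t) dt` of the heat content. -/
def laplaceHeatContent {d : ℕ} (Ω : Set (EuclideanSpace ℝ (Fin d)))
    [IsFiniteMeasure (volume.restrict Ω)] (s : ℝ) : ℝ :=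
  ∫ t in Set.Ioi (0 : ℝ), Real.exp (-s ^ 2 * t) * heatContent Ω t

/-- `f(s)` is exponentially small as `s → +∞`. -/
def ExponentiallySmall (f : ℝ → ℝ) : Prop :=
  ∃ κ : ℝ, 0 < κ ∧ f =O[atTop] fun s => Real.exp (-κ * s)

/-- `f(s) ∼ ∑_{n ≥ 2} c n / s ^ n` as an asymptotic series for `s → +∞`. -/
def HasWeylSeries (f : ℝ → ℝ) (c : ℕ → ℝ) : Prop :=
  ∀ N : ℕ, 2 ≤ N →
    (fun s => f s - ∑ n ∈ Finset.Icc 2 N, c n / s ^ n) =o[atTop] fun s => 1 / s ^ N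

end HeatContent

end

/-! The Laplace transform of a semigroup is the resolvent of its generator, so `∫ e^{-s²t} e^{tΔ}1
dt` is the solution `w` of `(s² - Δ) w = 1` with zero boundary values. The transform of the heat
content is therefore the mean of `w` over the ball.

On the abstract side, with `T = (1 - Δ)⁻¹`, the functional calculus turns the operator integral into
a scalar integral over the spectrum of `T` (`integral_laplace_semigroup_apply`). The equation for
`w` becomes `T (1 - (s² - 1) w) = w`. A smooth function satisfying the differential equation,
positive in the ball and nonpositive outside, satisfies this operator equation
(`dirichletResolvent_eq_of_classical`).

On the concrete side, `w = (1 - F(s²r²)/F(u²))/s²` with `u = Rs`, where `F(s²r²)` solves `Δv = s²v`.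
The radial equation has divergence form, so the mean is explicit: `s⁻² (1 - 2d F'(u²)/F(u²))`
(`laplaceHeatContent_ball`). For `d = 1` take `F(y) = cosh √y`; differentiating `F` raises the
dimension by two (`IsRadialProfile.deriv`), which gives `d = 3` and `d = 5`. The quotient is then
rational in `u` and `tanh u`. Replacing `tanh u` by `1` costs `O(e^{-2u})` and leaves the stated
rational functions, whose expansions in `1/s` are the Weyl series. -/

namespace HeatContent

/-! ### Functional calculus: the Laplace transform of the semigroup. -/

section Resolvent

variable {V H : Type*} [NormedAddCommGroup V] [InnerProductSpace ℂ V] [CompleteSpace V]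
  [NormedAddCommGroup H] [InnerProductSpace ℂ H] [CompleteSpace H]

theorem mulAdjoint_nonneg (J : V →L[ℂ] H) : 0 ≤ mulAdjoint J := by
  rw [ContinuousLinearMap.nonneg_iff_isPositive]
  exact ContinuousLinearMap.isPositive_self_comp_adjoint J

theorem isSelfAdjoint_mulAdjoint (J : V →L[ℂ] H) : IsSelfAdjoint (mulAdjoint J) :=
  IsSelfAdjoint.of_nonneg (mulAdjoint_nonneg J)

/-- The operator `J` does not increase norms. -/
def IsContraction (J : V →L[ℂ] H) : Prop := ∀ v, ‖J v‖ ≤ ‖v‖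

theorem norm_mulAdjoint_le_one {J : V →L[ℂ] H} (hJ : IsContraction J) : ‖mulAdjoint J‖ ≤ 1 := by
  have hJ' : ‖J‖ ≤ 1 :=
    ContinuousLinearMap.opNorm_le_bound _ zero_le_one fun v => by rw [one_mul]; exact hJ v
  calc ‖mulAdjoint J‖ ≤ ‖J‖ * ‖ContinuousLinearMap.adjoint J‖ :=
        ContinuousLinearMap.opNorm_comp_le _ _
    _ ≤ 1 * 1 := by
        rw [LinearIsometryEquiv.norm_map]
        gcongr
    _ = 1 := one_mul 1

/-- The functional calculus thus sees only `[0, 1]`, where the heat symbol is continuous and bounded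
by one. -/
theorem spectrum_mulAdjoint_subset {J : V →L[ℂ] H} (hJ : IsContraction J) :
    spectrum ℝ (mulAdjoint J) ⊆ Set.Icc 0 1 := by
  intro x hx
  refine ⟨spectrum_nonneg_of_nonneg (mulAdjoint_nonneg J) hx, ?_⟩
  rcases subsingleton_or_nontrivial H with h | h
  · simp [spectrum.of_subsingleton] at hx
  · have := spectrum.norm_le_norm_of_mem hx
    exact (le_abs_self x).trans (this.trans (norm_mulAdjoint_le_one hJ))

/-- The function of the resolvent that represents the heat semigroup. -/
noncomputable def heatSymbol (t x : ℝ) : ℝ := if x ≤ 0 then 0 else Real.exp (-t * (1 / x - 1))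

theorem heatSymbol_nonneg (t x : ℝ) : 0 ≤ heatSymbol t x := by
  unfold heatSymbol; split_ifs <;> positivity

theorem heatSymbol_le_one {t x : ℝ} (ht : 0 < t) (hx : x ≤ 1) : heatSymbol t x ≤ 1 := by
  unfold heatSymbol
  split_ifs with h
  · exact zero_le_one
  · rw [Real.exp_le_one_iff]
    have : 1 ≤ 1 / x := by rw [le_div_iff₀ (not_le.mp h)]; linarith
    nlinarith

/-- From `e^{-y} ≤ 1/y` with `y = t/x`. The linear decay in `x` gives joint continuity at `x = 0`.
-/
theorem heatSymbol_le {t x : ℝ} (ht : 0 < t) (hx : 0 ≤ x) :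
    heatSymbol t x ≤ Real.exp t * (x / t) := by
  unfold heatSymbol
  split_ifs with h
  · positivity
  · have hx0 := not_le.mp h
    rw [show -t * (1 / x - 1) = t + -(t / x) by ring, Real.exp_add]
    gcongr
    rw [Real.exp_neg, ← inv_div t x]
    have : t / x ≤ Real.exp (t / x) :=
      (by linarith : t / x ≤ t / x + 1).trans (Real.add_one_le_exp _)
    exact inv_anti₀ (by positivity) this

theorem continuousOn_heatSymbol :
    ContinuousOn (Function.uncurry heatSymbol) (Set.Ioi 0 ×ˢ Set.Icc 0 1) := by
  rintro ⟨t, x⟩ ⟨ht, hx0, hx1⟩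
  simp only [Set.mem_Ioi] at ht hx0 hx1
  rcases hx0.eq_or_lt with rfl | hx
  · have h0 : Function.uncurry heatSymbol (t, 0) = 0 := by simp [heatSymbol]
    rw [ContinuousWithinAt, h0]
    have hlim : Tendsto (fun p : ℝ × ℝ => Real.exp p.1 * (p.2 / p.1))
        (nhdsWithin (t, 0) (Set.Ioi 0 ×ˢ Set.Icc 0 1)) (nhds 0) := by
      have : ContinuousAt (fun p : ℝ × ℝ => Real.exp p.1 * (p.2 / p.1)) (t, 0) := by
        have : (t, (0 : ℝ)).1 ≠ 0 := ht.ne'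
        fun_prop (disch := assumption)
      simpa [ContinuousAt] using this.tendsto.mono_left nhdsWithin_le_nhds
    refine tendsto_of_tendsto_of_tendsto_of_le_of_le' tendsto_const_nhds hlim ?_ ?_
    · exact Eventually.of_forall fun p => heatSymbol_nonneg _ _
    · filter_upwards [self_mem_nhdsWithin] with p hp
      exact heatSymbol_le hp.1 hp.2.1
  · have hcont : ContinuousAt (fun p : ℝ × ℝ => Real.exp (-p.1 * (1 / p.2 - 1))) (t, x) := by
      have : (t, x).2 ≠ 0 := hx.ne'
      fun_prop (disch := assumption)
    refine (hcont.congr ?_).continuousWithinAt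
    have : ∀ᶠ p : ℝ × ℝ in nhds (t, x), 0 < p.2 :=
      continuousAt_snd.eventually (lt_mem_nhds hx)
    filter_upwards [this] with p hp
    simp [Function.uncurry, heatSymbol, not_le.mpr hp]

/-- With `x = 1/(1 + λ)` the integral is `1/(s² + λ)`. It is kept as a product with `x`, which makes
sense at `x = 0` and becomes a product with `T`. -/
theorem integral_heatSymbol {s x : ℝ} (hs : 0 < s) (hx0 : 0 ≤ x) (hx1 : x ≤ 1) :
    ∫ t in Set.Ioi (0 : ℝ), Real.exp (-s ^ 2 * t) * heatSymbol t x
      = (1 + (s ^ 2 - 1) * x)⁻¹ * x := by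
  rcases hx0.eq_or_lt with rfl | hx
  · simp [heatSymbol]
  · have hpos : 0 < s ^ 2 + (1 / x - 1) := by
      have : 1 ≤ 1 / x := by rw [le_div_iff₀ hx]; linarith
      positivity
    have : ∀ t, Real.exp (-s ^ 2 * t) * heatSymbol t x
        = Real.exp (-(s ^ 2 + (1 / x - 1)) * t) := by
      intro t
      rw [heatSymbol, if_neg (not_le.mpr hx), ← Real.exp_add]
      ring_nf
    simp_rw [this]
    rw [integral_exp_mul_Ioi (neg_lt_zero.mpr hpos)]
    have h2 : 1 + (s ^ 2 - 1) * x = x * (s ^ 2 + (1 / x - 1)) := by field_simp; ring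
    rw [h2, mul_inv, mul_zero, Real.exp_zero, neg_div_neg_eq, one_div]
    field_simp

theorem integrableOn_bound {s : ℝ} (hs : 0 < s) :
    HasFiniteIntegral (fun t : ℝ => Real.exp (-s ^ 2 * t)) (volume.restrict (Set.Ioi 0)) :=
  (integrableOn_exp_mul_Ioi (neg_lt_zero.mpr (by positivity)) 0).2

theorem continuousOn_laplace_heatSymbol {S : Set ℝ} (hS : S ⊆ Set.Icc 0 1) (s : ℝ) :
    ContinuousOn (Function.uncurry fun t x => Real.exp (-s ^ 2 * t) * heatSymbol t x)
      (Set.Ioi 0 ×ˢ S) := by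
  have h1 := continuousOn_heatSymbol.mono (Set.prod_mono_right (s := Set.Ioi 0) hS)
  have h2 : Continuous fun p : ℝ × ℝ => Real.exp (-s ^ 2 * p.1) := by fun_prop
  exact h2.continuousOn.mul h1

theorem laplace_heatSymbol_le {S : Set ℝ} (hS : S ⊆ Set.Icc 0 1) (s : ℝ) :
    ∀ᵐ t ∂(volume.restrict (Set.Ioi (0 : ℝ))), ∀ x ∈ S,
      ‖Real.exp (-s ^ 2 * t) * heatSymbol t x‖ ≤ Real.exp (-s ^ 2 * t) := by
  refine ae_restrict_of_forall_mem measurableSet_Ioi fun t ht x hx => ?_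
  rw [Real.norm_of_nonneg (mul_nonneg (Real.exp_nonneg _) (heatSymbol_nonneg _ _))]
  exact mul_le_of_le_one_right (Real.exp_nonneg _) (heatSymbol_le_one ht (hS hx).2)

variable {T : H →L[ℂ] H}

theorem cfc_laplace_heatSymbol (hT : spectrum ℝ T ⊆ Set.Icc 0 1) (s : ℝ) {t : ℝ}
    (ht : t ∈ Set.Ioi (0 : ℝ)) :
    cfc (fun x => Real.exp (-s ^ 2 * t) * heatSymbol t x) T
      = Real.exp (-s ^ 2 * t) • semigroupOfResolvent T t := by
  have hcont : ContinuousOn (heatSymbol t) (spectrum ℝ T) :=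
    continuousOn_heatSymbol.comp (f := fun x => (t, x)) (by fun_prop) fun x hx => ⟨ht, hT hx⟩
  exact cfc_const_mul _ _ _ hcont

theorem integrableOn_laplace_semigroup (hT : spectrum ℝ T ⊆ Set.Icc 0 1) (hsa : IsSelfAdjoint T)
    {s : ℝ} (hs : 0 < s) :
    IntegrableOn (fun t => Real.exp (-s ^ 2 * t) • semigroupOfResolvent T t) (Set.Ioi 0) :=
  (integrableOn_cfc measurableSet_Ioi (fun t x => Real.exp (-s ^ 2 * t) * heatSymbol t x)
    (fun t => Real.exp (-s ^ 2 * t)) T (continuousOn_laplace_heatSymbol hT s)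
    (laplace_heatSymbol_le hT s) (integrableOn_bound hs) hsa).congr_fun
    (fun _ ht => cfc_laplace_heatSymbol hT s ht) measurableSet_Ioi

/-- The Laplace transform of the semigroup is the resolvent of the generator. -/
theorem integral_laplace_semigroup_apply (hT : spectrum ℝ T ⊆ Set.Icc 0 1)
    (hsa : IsSelfAdjoint T) {s : ℝ} (hs : 0 < s) {f w : H}
    (hw : T (f - ((s ^ 2 - 1 : ℝ) : ℂ) • w) = w) :
    (∫ t in Set.Ioi (0 : ℝ), Real.exp (-s ^ 2 * t) • semigroupOfResolvent T t) f = w := by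
  -- The expression is `s² x + (1 - x)`, a sum of nonnegative terms that do not vanish together on
  -- `[0, 1]`.
  have hpos : ∀ x ∈ spectrum ℝ T, 0 < 1 + (s ^ 2 - 1) * x := by
    intro x hx
    obtain ⟨h0, h1⟩ := hT hx
    have : 0 < s ^ 2 := by positivity
    rcases h0.eq_or_lt with rfl | h0
    · simp
    · nlinarith [mul_pos this h0]
  have hcont : ContinuousOn (fun x : ℝ => (1 + (s ^ 2 - 1) * x)⁻¹) (spectrum ℝ T) := by
    refine ContinuousOn.inv₀ (by fun_prop) fun x hx => (hpos x hx).ne'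
  have h1 : ∫ t in Set.Ioi (0 : ℝ), Real.exp (-s ^ 2 * t) • semigroupOfResolvent T t
      = cfc (fun x : ℝ => (1 + (s ^ 2 - 1) * x)⁻¹) T * T := by
    rw [← setIntegral_congr_fun measurableSet_Ioi
      fun t ht => cfc_laplace_heatSymbol hT s ht,
      ← cfc_setIntegral measurableSet_Ioi (fun t x => Real.exp (-s ^ 2 * t) * heatSymbol t x)
        (fun t => Real.exp (-s ^ 2 * t)) T (continuousOn_laplace_heatSymbol hT s)
        (laplace_heatSymbol_le hT s) (integrableOn_bound hs) hsa]
    have : cfc (fun x : ℝ => (1 + (s ^ 2 - 1) * x)⁻¹) T * T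
        = cfc (fun x : ℝ => (1 + (s ^ 2 - 1) * x)⁻¹) T * cfc (fun x : ℝ => x) T := by
      rw [cfc_id' ℝ T hsa]
    rw [this, ← cfc_mul _ _ _ hcont (by fun_prop)]
    exact cfc_congr fun x hx => integral_heatSymbol hs (hT hx).1 (hT hx).2
  have h2 : cfc (fun x : ℝ => (1 + (s ^ 2 - 1) * x)⁻¹) T * (1 + (s ^ 2 - 1) • T) = 1 := by
    have : cfc (fun x : ℝ => 1 + (s ^ 2 - 1) * x) T = 1 + (s ^ 2 - 1) • T := by
      rw [cfc_const_add _ _ _ (by fun_prop) hsa, cfc_const_mul_id _ _ hsa]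
      simp
    rw [← this, ← cfc_mul _ _ _ hcont (by fun_prop), ← cfc_one ℝ T hsa]
    exact cfc_congr fun x hx => inv_mul_cancel₀ (hpos x hx).ne'
  -- The hypothesis `hw`, rearranged; the inverse of `1 + (s² - 1) T` from `h2` then recovers `w`.
  have h3 : T f = (1 + (s ^ 2 - 1) • T : H →L[ℂ] H) w := by
    rw [map_sub, map_smul, sub_eq_iff_eq_add] at hw
    rw [hw]
    simp only [add_apply, one_apply_eq_self,
      smul_apply, Complex.coe_smul]
  rw [h1, mul_apply_eq_comp, h3, ← mul_apply_eq_comp, h2,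
    one_apply_eq_self]

/-- `Re ⟪e, g⟫`. -/
noncomputable def rePairing (e g : H) : ℝ := (inner ℂ e g).re

/-- The functional `A ↦ Re ⟪e, A e⟫` on the bounded operators. -/
noncomputable def quadraticFunctional (e : H) : (H →L[ℂ] H) →L[ℝ] ℝ :=
  Complex.reCLM.comp
    (((innerSL ℂ e).comp (ContinuousLinearMap.apply ℂ H e)).restrictScalars ℝ)

theorem integrableOn_laplace_mulAdjoint {J : V →L[ℂ] H} (hJ : IsContraction J) (e : H)
    {s : ℝ} (hs : 0 < s) :
    IntegrableOn (fun t => Real.exp (-s ^ 2 * t) *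
      rePairing e (semigroupOfResolvent (mulAdjoint J) t e)) (Set.Ioi 0) := by
  have h := (quadraticFunctional e).integrable_comp
    (integrableOn_laplace_semigroup (spectrum_mulAdjoint_subset hJ)
      (isSelfAdjoint_mulAdjoint J) hs)
  simp_rw [map_smul] at h
  exact h

/-- When `mulAdjoint J` is `(1 - Δ)⁻¹`, the hypothesis `hw` reads `w - Δw = e - (s² - 1) w`, that
is, `(s² - Δ) w = e`. -/
theorem integral_laplace_mulAdjoint {J : V →L[ℂ] H} (hJ : IsContraction J) (e w : H)
    {s : ℝ} (hs : 0 < s) (hw : mulAdjoint J (e - ((s ^ 2 - 1 : ℝ) : ℂ) • w) = w) :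
    ∫ t in Set.Ioi (0 : ℝ), Real.exp (-s ^ 2 * t) *
      rePairing e (semigroupOfResolvent (mulAdjoint J) t e)
      = rePairing e w := by
  have h := (quadraticFunctional e).integral_comp_comm
    (integrableOn_laplace_semigroup (spectrum_mulAdjoint_subset hJ)
      (isSelfAdjoint_mulAdjoint J) hs)
  simp_rw [map_smul] at h
  refine Eq.trans h ?_
  change (inner ℂ e ((∫ t in Set.Ioi (0 : ℝ),
    Real.exp (-s ^ 2 * t) • semigroupOfResolvent (mulAdjoint J) t) e)).re = _
  rw [rePairing, integral_laplace_semigroup_apply (spectrum_mulAdjoint_subset hJ)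
    (isSelfAdjoint_mulAdjoint J) hs hw]

end Resolvent

/-! ### The heat content as a quadratic form of the semigroup. -/

section Functional

variable {d : ℕ} (Ω : Set (EuclideanSpace ℝ (Fin d)))

theorem isContraction_embed : IsContraction (V := H10 Ω) (H := L2 Ω) (embed Ω) := by
  intro v
  change ‖(v : FieldSpace Ω).fst‖ ≤ ‖(v : FieldSpace Ω)‖
  rw [← sq_le_sq₀ (norm_nonneg _) (norm_nonneg _), WithLp.prod_norm_sq_eq_of_L2]
  exact le_add_of_nonneg_right (sq_nonneg _)

variable [IsFiniteMeasure (volume.restrict Ω)]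

theorem rePairing_const_one (g : L2 Ω) :
    rePairing (H := L2 Ω) (Lp.const 2 (volume.restrict Ω) (1 : ℂ)) g = ∫ r in Ω, (g r).re := by
  have hint : Integrable (g : EuclideanSpace ℝ (Fin d) → ℂ) (volume.restrict Ω) :=
    (Lp.memLp g).integrable (by norm_num)
  have h2 : ∫ r in Ω, inner ℂ (Lp.const 2 (volume.restrict Ω) (1 : ℂ) r) (g r) = ∫ r in Ω, g r := by
    refine integral_congr_ae ?_
    filter_upwards [Lp.coeFn_const (p := 2) (μ := volume.restrict Ω) (1 : ℂ)] with r hr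
    rw [hr]
    simp
  rw [rePairing, L2.inner_def, h2]
  exact (integral_re hint).symm

theorem heatContent_eq (t : ℝ) :
    heatContent Ω t = (1 / volume.real Ω) *
      rePairing (H := L2 Ω) (Lp.const 2 (volume.restrict Ω) (1 : ℂ))
        (semigroupOfResolvent (H := L2 Ω) (mulAdjoint (V := H10 Ω) (H := L2 Ω) (embed Ω)) t
          (Lp.const 2 (volume.restrict Ω) (1 : ℂ))) := by
  rw [rePairing_const_one]
  rfl

theorem integrableOn_laplace_heatContent {s : ℝ} (hs : 0 < s) :
    IntegrableOn (fun t => Real.exp (-s ^ 2 * t) * heatContent Ω t) (Set.Ioi 0) := by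
  have h := integrableOn_laplace_mulAdjoint (V := H10 Ω) (H := L2 Ω) (isContraction_embed Ω)
    (Lp.const 2 (volume.restrict Ω) (1 : ℂ)) hs
  simp_rw [heatContent_eq, mul_left_comm (Real.exp _)]
  exact h.const_mul _

theorem laplaceHeatContent_eq {s : ℝ} (hs : 0 < s) {w : L2 Ω}
    (hw : dirichletResolvent Ω
      (Lp.const 2 (volume.restrict Ω) (1 : ℂ) - ((s ^ 2 - 1 : ℝ) : ℂ) • w) = w) :
    laplaceHeatContent Ω s = (1 / volume.real Ω) * ∫ r in Ω, (w r).re := by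
  unfold laplaceHeatContent
  have h := integral_laplace_mulAdjoint (V := H10 Ω) (H := L2 Ω) (isContraction_embed Ω)
    (Lp.const 2 (volume.restrict Ω) (1 : ℂ)) w hs hw
  simp_rw [heatContent_eq, mul_left_comm (Real.exp _)]
  rw [integral_const_mul, ← rePairing_const_one]
  exact congrArg _ h

end Functional

/-! ### A smooth truncation of the identity. -/

section Cutoff

/-- A smooth function that vanishes on `(-∞, 1]` and is the identity on `[2, ∞)`. -/
noncomputable def cutoff (z : ℝ) : ℝ := z * Real.smoothTransition (z - 1)

theorem contDiff_cutoff : ContDiff ℝ ∞ cutoff :=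
  contDiff_id.mul (Real.smoothTransition.contDiff.comp (contDiff_id.sub contDiff_const))

theorem cutoff_of_le_one {z : ℝ} (hz : z ≤ 1) : cutoff z = 0 := by
  rw [cutoff, Real.smoothTransition.zero_of_nonpos (by linarith), mul_zero]

theorem cutoff_of_two_le {z : ℝ} (hz : 2 ≤ z) : cutoff z = z := by
  rw [cutoff, Real.smoothTransition.one_of_one_le (by linarith), mul_one]

theorem abs_cutoff_le (z : ℝ) : |cutoff z| ≤ |z| := by
  rw [cutoff, abs_mul, abs_of_nonneg (Real.smoothTransition.nonneg _)]
  exact mul_le_of_le_one_right (abs_nonneg z) (Real.smoothTransition.le_one _)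

theorem deriv_cutoff_of_lt_one {z : ℝ} (hz : z < 1) : deriv cutoff z = 0 := by
  have : cutoff =ᶠ[nhds z] fun _ => 0 := by
    filter_upwards [gt_mem_nhds hz] with y hy using cutoff_of_le_one hy.le
  rw [this.deriv_eq, deriv_const]

theorem deriv_cutoff_of_two_lt {z : ℝ} (hz : 2 < z) : deriv cutoff z = 1 := by
  have : cutoff =ᶠ[nhds z] fun y => y := by
    filter_upwards [lt_mem_nhds hz] with y hy using cutoff_of_two_le hy.le
  rw [this.deriv_eq, deriv_id'']

/-- The derivative is `0` below `1` and `1` above `2`; compactness covers the interval between. The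
bound keeps the gradients of the truncated functions uniformly bounded. -/
theorem exists_abs_deriv_cutoff_le : ∃ M : ℝ, ∀ z, |deriv cutoff z| ≤ M := by
  have hc : Continuous (deriv cutoff) := contDiff_cutoff.continuous_deriv (by simp)
  obtain ⟨M, hM⟩ := (isCompact_Icc (a := (1 : ℝ)) (b := 2)).exists_bound_of_continuousOn
    hc.continuousOn
  refine ⟨max M 1, fun z => ?_⟩
  rcases lt_or_ge z 1 with h1 | h1
  · simp [deriv_cutoff_of_lt_one h1]
  · rcases lt_or_ge 2 z with h2 | h2
    · simp [deriv_cutoff_of_two_lt h2]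
    · exact (hM z ⟨h1, h2⟩).trans (le_max_left _ _)

end Cutoff

/-! ### Membership of smooth functions in `H¹₀(Ω)`. -/

section FieldPair

variable {d : ℕ} {Ω : Set (EuclideanSpace ℝ (Fin d))}

theorem exists_bound_of_continuous (hb : Bornology.IsBounded Ω)
    {g : EuclideanSpace ℝ (Fin d) → ℂ} (hg : Continuous g) : ∃ C, ∀ x ∈ Ω, ‖g x‖ ≤ C := by
  obtain ⟨C, hC⟩ := hb.isCompact_closure.exists_bound_of_continuousOn hg.continuousOn
  exact ⟨C, fun x hx => hC x (subset_closure hx)⟩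

variable [IsFiniteMeasure (volume.restrict Ω)]

theorem memLp_restrict_of_continuous (hm : MeasurableSet Ω) (hb : Bornology.IsBounded Ω)
    {g : EuclideanSpace ℝ (Fin d) → ℂ} (hg : Continuous g) : MemLp g 2 (volume.restrict Ω) := by
  obtain ⟨C, hC⟩ := exists_bound_of_continuous hb hg
  exact MemLp.of_bound hg.aestronglyMeasurable C (ae_restrict_of_forall_mem hm hC)

/-- Bounded convergence in `L²`, obtained from Vitali's theorem: a uniform bound on a finite measure
space gives uniform integrability. -/
theorem tendsto_toLp_of_bounded (hm : MeasurableSet Ω)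
    {f : ℕ → EuclideanSpace ℝ (Fin d) → ℂ} {g : EuclideanSpace ℝ (Fin d) → ℂ}
    (hf : ∀ n, MemLp (f n) 2 (volume.restrict Ω)) (hg : MemLp g 2 (volume.restrict Ω)) {C : ℝ}
    (hC : ∀ n, ∀ x ∈ Ω, ‖f n x‖ ≤ C)
    (hlim : ∀ x ∈ Ω, Tendsto (fun n => f n x) atTop (nhds (g x))) :
    Tendsto (fun n => (hf n).toLp (f n)) atTop (nhds (hg.toLp g)) := by
  rw [Lp.tendsto_Lp_iff_tendsto_eLpNorm'']
  refine tendsto_Lp_finite_of_tendsto_ae one_le_two ENNReal.ofNat_ne_top (fun n => (hf n).1) hg ?_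
    (ae_restrict_of_forall_mem hm hlim)
  -- Above the threshold `C + 1` no point of `Ω` remains, so the truncated functions vanish almost
  -- everywhere.
  refine unifIntegrable_of one_le_two ENNReal.ofNat_ne_top (fun n => (hf n).1) fun ε _ =>
    ⟨Real.toNNReal (C + 1), fun n => ?_⟩
  have h0 : {x | Real.toNNReal (C + 1) ≤ ‖f n x‖₊}.indicator (f n)
      =ᵐ[volume.restrict Ω] fun _ => 0 := by
    refine ae_restrict_of_forall_mem hm fun x hx => ?_
    refine Set.indicator_of_notMem (fun h => ?_) _
    have h1 : C + 1 ≤ ‖f n x‖ := Real.toNNReal_le_iff_le_coe.mp h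
    linarith [hC n x hx]
  rw [eLpNorm_congr_ae h0]
  simp

/-- The pair `(φ, ∇φ)` of a continuously differentiable function on a bounded set. -/
noncomputable def fieldPair (hm : MeasurableSet Ω) (hb : Bornology.IsBounded Ω)
    {φ : EuclideanSpace ℝ (Fin d) → ℂ} (hφ : ContDiff ℝ 1 φ) : FieldSpace Ω :=
  WithLp.toLp 2 ((memLp_restrict_of_continuous hm hb hφ.continuous).toLp φ,
    WithLp.toLp 2 fun i => (memLp_restrict_of_continuous hm hb
      ((hφ.continuous_fderiv one_ne_zero).clm_apply continuous_const)).toLp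
        (fun x => fderiv ℝ φ x (EuclideanSpace.single i 1)))

theorem fieldPair_fst_ae (hm : MeasurableSet Ω) (hb : Bornology.IsBounded Ω)
    {φ : EuclideanSpace ℝ (Fin d) → ℂ} (hφ : ContDiff ℝ 1 φ) :
    (fieldPair hm hb hφ).fst =ᵐ[volume.restrict Ω] φ :=
  (memLp_restrict_of_continuous hm hb hφ.continuous).coeFn_toLp

theorem fieldPair_snd_ae (hm : MeasurableSet Ω) (hb : Bornology.IsBounded Ω)
    {φ : EuclideanSpace ℝ (Fin d) → ℂ} (hφ : ContDiff ℝ 1 φ) (i : Fin d) :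
    (fieldPair hm hb hφ).snd i =ᵐ[volume.restrict Ω]
      fun x => fderiv ℝ φ x (EuclideanSpace.single i 1) :=
  (memLp_restrict_of_continuous hm hb
    ((hφ.continuous_fderiv one_ne_zero).clm_apply continuous_const)).coeFn_toLp

theorem fieldPair_mem_H10_of_tsupport (hm : MeasurableSet Ω) (hb : Bornology.IsBounded Ω)
    {φ : EuclideanSpace ℝ (Fin d) → ℂ} (hφ : ContDiff ℝ ∞ φ) (hc : HasCompactSupport φ)
    (hs : tsupport φ ⊆ Ω) : fieldPair hm hb (hφ.of_le (by simp)) ∈ H10 Ω :=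
  Submodule.le_topologicalClosure _ (Submodule.subset_span
    ⟨φ, hφ, hc, hs, fieldPair_fst_ae hm hb _, fieldPair_snd_ae hm hb _⟩)

theorem tendsto_fieldPair (hm : MeasurableSet Ω) (hb : Bornology.IsBounded Ω)
    {φ : ℕ → EuclideanSpace ℝ (Fin d) → ℂ} {ψ : EuclideanSpace ℝ (Fin d) → ℂ}
    (hφ : ∀ n, ContDiff ℝ 1 (φ n)) (hψ : ContDiff ℝ 1 ψ) {C C' : ℝ}
    (hC : ∀ n, ∀ x ∈ Ω, ‖φ n x‖ ≤ C)
    (hC' : ∀ n, ∀ x ∈ Ω, ‖fderiv ℝ (φ n) x‖ ≤ C')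
    (hlim : ∀ x ∈ Ω, Tendsto (fun n => φ n x) atTop (nhds (ψ x)))
    (hlim' : ∀ x ∈ Ω, Tendsto (fun n => fderiv ℝ (φ n) x) atTop (nhds (fderiv ℝ ψ x))) :
    Tendsto (fun n => fieldPair hm hb (hφ n)) atTop (nhds (fieldPair hm hb hψ)) := by
  refine (WithLp.prod_continuous_toLp 2 _ _).continuousAt.tendsto.comp ?_
  refine Tendsto.prodMk_nhds (tendsto_toLp_of_bounded hm _ _ hC hlim) ?_
  refine (PiLp.continuous_toLp 2 _).continuousAt.tendsto.comp ?_
  refine tendsto_pi_nhds.mpr fun i => ?_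
  refine tendsto_toLp_of_bounded (C := C') hm _ _ (fun n x hx => ?_) fun x hx => ?_
  · refine (ContinuousLinearMap.le_opNorm _ _).trans ?_
    simpa using hC' n x hx
  · exact ((ContinuousLinearMap.apply ℝ ℂ (EuclideanSpace.single i (1 : ℝ))).continuous.tendsto
      _).comp (hlim' x hx)

/-- A smooth function that is positive exactly in `Ω` belongs to `H¹₀(Ω)`. -/
theorem fieldPair_mem_H10 (hm : MeasurableSet Ω) (hb : Bornology.IsBounded Ω)
    {W : EuclideanSpace ℝ (Fin d) → ℝ} (hW : ContDiff ℝ ∞ W) (hpos : ∀ x ∈ Ω, 0 < W x)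
    (hneg : ∀ x ∉ Ω, W x ≤ 0) (hW' : ContDiff ℝ 1 fun x => (W x : ℂ)) :
    fieldPair hm hb hW' ∈ H10 Ω := by
  obtain ⟨M, hM⟩ := exists_abs_deriv_cutoff_le
  have hM0 : 0 ≤ M := (abs_nonneg _).trans (hM 0)
  let N : ℕ → ℝ := fun n => (n : ℝ) + 1
  have hN : ∀ n, 0 < N n := fun n => by positivity
  have hNlim : Tendsto N atTop atTop :=
    tendsto_atTop_add_const_right _ _ tendsto_natCast_atTop_atTop
  -- The approximant `φ n` is supported where `W ≥ 1/N` and equals `W` where `W ≥ 2/N`. Its gradient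
  -- is `cutoff'(N W) ∇W`, since the two factors `N` cancel; hence both `φ n` and its gradient stay
  -- bounded and converge pointwise in `Ω`.
  let φ : ℕ → EuclideanSpace ℝ (Fin d) → ℂ := fun n x => ((cutoff (N n * W x) / N n : ℝ) : ℂ)
  have hφ : ∀ n, ContDiff ℝ ∞ (φ n) := fun n =>
    Complex.ofRealCLM.contDiff.comp ((contDiff_cutoff.comp (contDiff_const.mul hW)).div_const _)
  have hWd : ∀ x, HasFDerivAt W (fderiv ℝ W x) x := fun x =>
    (hW.differentiable (by simp) x).hasFDerivAt
  have hWfd : ∀ x, fderiv ℝ (fun x => (W x : ℂ)) x = Complex.ofRealCLM.comp (fderiv ℝ W x) :=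
    fun x => (Complex.ofRealCLM.hasFDerivAt.comp x (hWd x)).fderiv
  have hφfd : ∀ n x, fderiv ℝ (φ n) x
      = deriv cutoff (N n * W x) • Complex.ofRealCLM.comp (fderiv ℝ W x) := by
    intro n x
    have h1 : HasDerivAt cutoff (deriv cutoff (N n * W x)) (N n * W x) :=
      (contDiff_cutoff.differentiable (by simp) _).hasDerivAt
    have h2 : HasFDerivAt (fun x => cutoff (N n * W x))
        (deriv cutoff (N n * W x) • (N n • fderiv ℝ W x)) x :=
      HasDerivAt.comp_hasFDerivAt (h₂ := cutoff) (f := fun x => N n * W x) x h1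
        ((hWd x).const_mul (N n))
    have h3 := Complex.ofRealCLM.hasFDerivAt.comp x (h2.mul_const (N n)⁻¹)
    refine (HasFDerivAt.fderiv h3).trans ?_
    ext v
    have : (N n : ℂ) ≠ 0 := Complex.ofReal_ne_zero.mpr (hN n).ne'
    simp
    field_simp
  have hmem : ∀ n, fieldPair hm hb ((hφ n).of_le (by simp)) ∈ H10 Ω := by
    intro n
    have hsub : tsupport (φ n) ⊆ {x | 1 ≤ N n * W x} := by
      refine closure_minimal (fun x hx => ?_)
        (isClosed_le continuous_const (continuous_const.mul hW.continuous))
      by_contra hlt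
      refine hx ?_
      simp only [Set.mem_ofPred_eq, not_le] at hlt
      simp [φ, cutoff_of_le_one hlt.le]
    have hsub' : tsupport (φ n) ⊆ Ω := by
      intro x hx
      by_contra hxΩ
      have h1 : 1 ≤ N n * W x := hsub hx
      nlinarith [hneg x hxΩ, hN n]
    exact fieldPair_mem_H10_of_tsupport hm hb (hφ n)
      (Metric.isCompact_of_isClosed_isBounded (isClosed_tsupport _) (hb.subset hsub')) hsub'
  obtain ⟨C, hC⟩ := exists_bound_of_continuous hb hW'.continuous
  obtain ⟨C', hC'⟩ := hb.isCompact_closure.exists_bound_of_continuousOn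
    (hW'.continuous_fderiv one_ne_zero).continuousOn
  have hlarge : ∀ x ∈ Ω, ∀ᶠ n in atTop, 2 < N n * W x := fun x hx =>
    (hNlim.atTop_mul_const (hpos x hx)).eventually_gt_atTop 2
  refine (Submodule.isClosed_topologicalClosure _).mem_of_tendsto
    (tendsto_fieldPair hm hb (C := C) (C' := M * C') (fun n => (hφ n).of_le (by simp)) hW'
      ?_ ?_ ?_ ?_) (Eventually.of_forall hmem)
  · intro n x hx
    refine le_trans ?_ (hC x hx)
    simp only [φ, Complex.norm_real, Real.norm_eq_abs, abs_div, abs_of_pos (hN n)]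
    rw [div_le_iff₀ (hN n)]
    refine (abs_cutoff_le _).trans ?_
    rw [abs_mul, abs_of_pos (hN n), mul_comm]
  · intro n x hx
    rw [hφfd, norm_smul, ← hWfd]
    exact mul_le_mul (hM _) (hC' x (subset_closure hx)) (norm_nonneg _) hM0
  · intro x hx
    refine tendsto_const_nhds.congr' ?_
    filter_upwards [hlarge x hx] with n hn
    simp only [φ]
    rw [cutoff_of_two_le hn.le, mul_div_cancel_left₀ _ (hN n).ne']
  · intro x hx
    refine tendsto_const_nhds.congr' ?_
    filter_upwards [hlarge x hx] with n hn
    rw [hφfd, deriv_cutoff_of_two_lt hn, one_smul, hWfd]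

end FieldPair

theorem mulAdjoint_apply_eq {V H : Type*} [NormedAddCommGroup V] [InnerProductSpace ℂ V]
    [CompleteSpace V] [NormedAddCommGroup H] [InnerProductSpace ℂ H] [CompleteSpace H]
    {J : V →L[ℂ] H} {p : V} {f : H} (h : ∀ v, inner ℂ p v = inner ℂ f (J v)) :
    mulAdjoint J f = J p := by
  have : ContinuousLinearMap.adjoint J f = p :=
    ext_inner_right ℂ fun v => by rw [ContinuousLinearMap.adjoint_inner_left, h]
  rw [mulAdjoint, ContinuousLinearMap.comp_apply, this]

theorem eqOn_topologicalClosure_span {E : Type*} [NormedAddCommGroup E] [InnerProductSpace ℂ E]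
    {S : Set E} {f g : E →L[ℂ] ℂ} (h : ∀ v ∈ S, f v = g v) :
    ∀ v ∈ (Submodule.span ℂ S).topologicalClosure, f v = g v := by
  have h1 : Set.EqOn f g (Submodule.span ℂ S) := LinearMap.eqOn_span (f := f.toLinearMap)
    (g := g.toLinearMap) h
  exact h1.closure f.continuous g.continuous

/-! ### Classical solutions are weak solutions. -/

section WeakSolution

variable {d : ℕ} {Ω : Set (EuclideanSpace ℝ (Fin d))}

/-- Both sides of the weak equation are continuous and linear in `v`, so testing against the
spanning pairs is enough; uniqueness in the definition of the adjoint then identifies `p`. -/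
theorem dirichletResolvent_apply {p : FieldSpace Ω} (hp : p ∈ H10 Ω) {f : L2 Ω}
    (h : ∀ v ∈ testPairs Ω, inner ℂ p v = inner ℂ f v.fst) :
    dirichletResolvent Ω f = p.fst := by
  have h1 : ∀ v ∈ H10 Ω, inner ℂ p v = inner ℂ f v.fst :=
    eqOn_topologicalClosure_span (f := innerSL ℂ p)
      (g := (innerSL ℂ f).comp (WithLp.fstL 2 ℂ (L2 Ω) (PiLp 2 (fun _ : Fin d => L2 Ω)))) h
  have h2 : ∀ v : H10 Ω, inner ℂ (⟨p, hp⟩ : H10 Ω) v = inner ℂ f (embed Ω v) :=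
    fun v => h1 v v.2
  exact mulAdjoint_apply_eq (V := H10 Ω) (H := L2 Ω) h2

/-- Passing to an integral over the whole space allows integration by parts without a boundary term.
-/
theorem inner_eq_integral_smul {f g : L2 Ω} {W : EuclideanSpace ℝ (Fin d) → ℝ}
    {φ : EuclideanSpace ℝ (Fin d) → ℂ} (hf : f =ᵐ[volume.restrict Ω] fun x => (W x : ℂ))
    (hg : g =ᵐ[volume.restrict Ω] φ) (hφ : ∀ x ∉ Ω, φ x = 0) :
    inner ℂ f g = ∫ x, W x • φ x := by
  rw [L2.inner_def, ← setIntegral_eq_integral_of_forall_compl_eq_zero (s := Ω)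
    (f := fun x => W x • φ x) (fun x hx => by rw [hφ x hx, smul_zero])]
  refine integral_congr_ae ?_
  filter_upwards [hf, hg] with x h1 h2
  rw [h1, h2]
  simp [mul_comm]

theorem integrable_smul_of_hasCompactSupport {W : EuclideanSpace ℝ (Fin d) → ℝ}
    {φ : EuclideanSpace ℝ (Fin d) → ℂ} (hW : Continuous W) (hφ : Continuous φ)
    (hc : HasCompactSupport φ) : Integrable fun x => W x • φ x :=
  (hW.smul hφ).integrable_of_hasCompactSupport hc.smul_left

theorem integral_fderiv_smul_fderiv {W : EuclideanSpace ℝ (Fin d) → ℝ}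
    {φ : EuclideanSpace ℝ (Fin d) → ℂ} (hW : ContDiff ℝ 1 W) (hφ : ContDiff ℝ 1 φ)
    (hc : HasCompactSupport φ) (v : EuclideanSpace ℝ (Fin d)) :
    ∫ x, W x • fderiv ℝ φ x v = - ∫ x, fderiv ℝ W x v • φ x := by
  have hW' : Continuous fun x => fderiv ℝ W x v :=
    (hW.continuous_fderiv one_ne_zero).clm_apply continuous_const
  have hφ' : Continuous fun x => fderiv ℝ φ x v :=
    (hφ.continuous_fderiv one_ne_zero).clm_apply continuous_const
  exact integral_smul_fderiv_eq_neg_fderiv_smul_of_integrable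
    (integrable_smul_of_hasCompactSupport hW' hφ.continuous hc)
    (integrable_smul_of_hasCompactSupport hW.continuous hφ' (hc.fderiv_apply ℝ v))
    (integrable_smul_of_hasCompactSupport hW.continuous hφ.continuous hc)
    (fun x _ => hW.differentiable one_ne_zero x) (fun x _ => hφ.differentiable one_ne_zero x)

variable [IsFiniteMeasure (volume.restrict Ω)]

/-- A classical solution of `W - ΔW = g` that vanishes on the boundary is the weak solution. -/
theorem dirichletResolvent_eq_of_classical (hm : MeasurableSet Ω) (hb : Bornology.IsBounded Ω)
    {W g : EuclideanSpace ℝ (Fin d) → ℝ} (hW : ContDiff ℝ ∞ W)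
    (hpos : ∀ x ∈ Ω, 0 < W x) (hneg : ∀ x ∉ Ω, W x ≤ 0)
    (hΔ : ∀ x, W x - ∑ i : Fin d, fderiv ℝ (fun y => fderiv ℝ W y (EuclideanSpace.single i 1)) x
      (EuclideanSpace.single i 1) = g x) {f w : L2 Ω}
    (hf : f =ᵐ[volume.restrict Ω] fun x => (g x : ℂ))
    (hw : w =ᵐ[volume.restrict Ω] fun x => (W x : ℂ)) :
    dirichletResolvent Ω f = w := by
  have hWC : ContDiff ℝ 1 fun x => (W x : ℂ) :=
    Complex.ofRealCLM.contDiff.comp (hW.of_le (by simp))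
  have hWfd : ∀ x v, fderiv ℝ (fun x => (W x : ℂ)) x v = ((fderiv ℝ W x v : ℝ) : ℂ) :=
    fun x v => by
      have := (Complex.ofRealCLM.hasFDerivAt.comp x
        (hW.differentiable (by simp) x).hasFDerivAt).fderiv
      exact congrArg (fun L => L v) this
  have hpfst := fieldPair_fst_ae hm hb hWC
  have hfst : (fieldPair hm hb hWC).fst = w := Lp.ext (hpfst.trans hw.symm)
  rw [← hfst]
  refine dirichletResolvent_apply (fieldPair_mem_H10 hm hb hW hpos hneg hWC) ?_
  rintro v ⟨φ, hφ, hc, hs, hv1, hv2⟩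
  have hφ0 : ∀ x ∉ Ω, φ x = 0 := fun x hx => image_eq_zero_of_notMem_tsupport fun h => hx (hs h)
  have hφ1 : ∀ e, ∀ x ∉ Ω, fderiv ℝ φ x e = 0 := fun e x hx => by
    have : fderiv ℝ φ x = 0 := image_eq_zero_of_notMem_tsupport
      fun h => hx (hs (tsupport_fderiv_subset ℝ h))
    rw [this, zero_apply]
  rw [WithLp.prod_inner_apply, PiLp.inner_apply, inner_eq_integral_smul hf hv1 hφ0]
  have hsnd : ∀ i, inner ℂ ((fieldPair hm hb hWC).snd i) (v.snd i)
      = - ∫ x, fderiv ℝ (fun y => fderiv ℝ W y (EuclideanSpace.single i 1)) x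
      (EuclideanSpace.single i 1) • φ x := by
    intro i
    rw [inner_eq_integral_smul (W := fun x => fderiv ℝ W x (EuclideanSpace.single i 1))
      ?_ (hv2 i) (hφ1 _)]
    · refine integral_fderiv_smul_fderiv ?_ (hφ.of_le (by simp)) hc _
      exact (hW.fderiv_right (m := 1) (by norm_cast)).clm_apply contDiff_const
    · filter_upwards [fieldPair_snd_ae hm hb hWC i] with x hx
      rw [hx, hWfd]
  have hΔc : ∀ i : Fin d, Continuous fun x =>
      fderiv ℝ (fun y => fderiv ℝ W y (EuclideanSpace.single i 1)) x
        (EuclideanSpace.single i 1) := fun i =>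
    (((hW.fderiv_right (m := 1) (by norm_cast)).clm_apply contDiff_const).continuous_fderiv
      one_ne_zero).clm_apply continuous_const
  refine (congrArg₂ (· + ·) (inner_eq_integral_smul hpfst hv1 hφ0)
    (Finset.sum_congr rfl fun i _ => hsnd i)).trans ?_
  rw [Finset.sum_neg_distrib, ← integral_finsetSum _ fun i _ =>
    integrable_smul_of_hasCompactSupport (hΔc i) hφ.continuous hc, ← sub_eq_add_neg,
    ← integral_sub (integrable_smul_of_hasCompactSupport hW.continuous hφ.continuous hc)
      (integrable_finsetSum _ fun i _ =>
        integrable_smul_of_hasCompactSupport (hΔc i) hφ.continuous hc)]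
  refine integral_congr_ae (Eventually.of_forall fun x => ?_)
  simp only
  rw [← Finset.sum_smul, ← sub_smul, hΔ]

end WeakSolution

/-! ### Radial solutions of `Δu = s²u`. -/

/-- A smooth profile `F` such that `x ↦ F (s² ‖x‖²)` is a radial solution of `Δ u = s² u` in
dimension `d`, positive for `x ≠ 0`. -/
structure IsRadialProfile (d : ℕ) (F : ℝ → ℝ) : Prop where
  contDiff : ContDiff ℝ ∞ F
  ode : ∀ y, 0 ≤ y → 4 * y * deriv (deriv F) y + 2 * d * deriv F y = F y
  pos : ∀ y, 0 < y → 0 < F y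

namespace IsRadialProfile

variable {d : ℕ} {F : ℝ → ℝ} (hF : IsRadialProfile d F)
include hF

theorem hasDerivAt (y : ℝ) : HasDerivAt F (deriv F y) y :=
  (hF.contDiff.differentiable (by simp) y).hasDerivAt

theorem contDiff_deriv : ContDiff ℝ ∞ (deriv F) :=
  (contDiff_infty_iff_deriv.mp hF.contDiff).2

theorem hasDerivAt_deriv (y : ℝ) : HasDerivAt (deriv F) (deriv (deriv F) y) y :=
  (hF.contDiff_deriv.differentiable (by simp) y).hasDerivAt

/-- The radial equation in divergence form: by `ode`, the integrand is the derivative of `2 y^d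
F'(s²y²)`, which vanishes at `y = 0` because `0 < d`. -/
theorem intervalIntegral_eq (hd : 0 < d) (R s : ℝ) :
    ∫ y in (0 : ℝ)..R, y ^ (d - 1) * F (s ^ 2 * y ^ 2) = 2 * R ^ d * deriv F ((R * s) ^ 2) := by
  have hderiv : ∀ y : ℝ, HasDerivAt (fun y => 2 * y ^ d * deriv F (s ^ 2 * y ^ 2))
      (y ^ (d - 1) * F (s ^ 2 * y ^ 2)) y := by
    intro y
    have h1 : HasDerivAt (fun y : ℝ => s ^ 2 * y ^ 2) (s ^ 2 * (2 * y)) y := by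
      simpa using (hasDerivAt_pow 2 y).const_mul (s ^ 2)
    have h2 := ((hasDerivAt_pow d y).const_mul 2).mul
      ((hF.hasDerivAt_deriv (s ^ 2 * y ^ 2)).comp y h1)
    refine h2.congr_deriv ?_
    rw [← hF.ode (s ^ 2 * y ^ 2) (by positivity)]
    have hpow : y ^ d = y * y ^ (d - 1) := (mul_pow_sub_one hd.ne' y).symm
    simp only [Function.comp_apply, hpow]
    ring
  have hcont : Continuous fun y : ℝ => y ^ (d - 1) * F (s ^ 2 * y ^ 2) := by
    have := hF.contDiff.continuous
    fun_prop
  rw [intervalIntegral.integral_eq_sub_of_hasDerivAt (fun y _ => hderiv y)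
    (hcont.intervalIntegrable _ _)]
  simp [hd.ne', mul_pow, mul_comm]

/-- Taking `s = 1` and `R = √y` in `intervalIntegral_eq` makes `F'(y)` a positive multiple of the
integral of a positive function. -/
theorem deriv_pos (hd : 0 < d) {y : ℝ} (hy : 0 < y) : 0 < deriv F y := by
  have h1 := hF.intervalIntegral_eq hd (√y) 1
  have h2 : 0 < ∫ r in (0 : ℝ)..√y, r ^ (d - 1) * F (1 ^ 2 * r ^ 2) := by
    have hcont : Continuous fun r : ℝ => r ^ (d - 1) * F (1 ^ 2 * r ^ 2) := by
      have := hF.contDiff.continuous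
      fun_prop
    refine intervalIntegral.intervalIntegral_pos_of_pos_on (hcont.intervalIntegrable _ _)
      (fun r hr => ?_) (Real.sqrt_pos.mpr hy)
    have h0 : 0 < r := hr.1
    exact mul_pos (by positivity) (hF.pos _ (by positivity))
  rw [h1, mul_one, Real.sq_sqrt hy.le] at h2
  exact pos_of_mul_pos_right h2 (by positivity)

theorem strictMonoOn (hd : 0 < d) : StrictMonoOn F (Set.Ici 0) := by
  refine strictMonoOn_of_deriv_pos (convex_Ici 0) hF.contDiff.continuous.continuousOn ?_
  intro y hy
  rw [interior_Ici] at hy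
  exact hF.deriv_pos hd hy

/-- The derivative of a radial profile is a radial profile in two more dimensions. -/
theorem deriv (hd : 0 < d) : IsRadialProfile (d + 2) (deriv F) where
  contDiff := hF.contDiff_deriv
  pos _ hy := hF.deriv_pos hd hy
  ode := by
    have hc2 : ContDiff ℝ ∞ (_root_.deriv (_root_.deriv F)) :=
      (contDiff_infty_iff_deriv.mp hF.contDiff_deriv).2
    have hc3 : ContDiff ℝ ∞ (_root_.deriv (_root_.deriv (_root_.deriv F))) :=
      (contDiff_infty_iff_deriv.mp hc2).2
    -- Differentiating the equation gives `4yF''' + (4 + 2d)F'' = F'`, and `4 + 2d = 2(d + 2)`. The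
    -- equation is known only for `y ≥ 0`, so this is done in the open half-line; continuity adds `y
    -- = 0`.
    have hpos : ∀ y ∈ Set.Ioi (0 : ℝ), 4 * y * _root_.deriv (_root_.deriv (_root_.deriv F)) y
        + 2 * (d + 2 : ℕ) * _root_.deriv (_root_.deriv F) y = _root_.deriv F y := by
      intro y hy
      have h1 : F =ᶠ[nhds y] fun y => 4 * y * _root_.deriv (_root_.deriv F) y
          + 2 * d * _root_.deriv F y := by
        filter_upwards [lt_mem_nhds hy] with z hz using (hF.ode z hz.le).symm
      have h2 : HasDerivAt (fun y => 4 * y * _root_.deriv (_root_.deriv F) y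
          + 2 * d * _root_.deriv F y) _ y :=
        ((((hasDerivAt_id y).const_mul 4).mul
          (hc2.differentiable (by simp) y).hasDerivAt)).add
          ((hF.hasDerivAt_deriv y).const_mul (2 * (d : ℝ)))
      have h3 := h1.deriv_eq.trans h2.deriv
      rw [h3]
      push_cast
      simp only [id]
      ring
    have hcl : Set.EqOn (fun y => 4 * y * _root_.deriv (_root_.deriv (_root_.deriv F)) y
        + 2 * (d + 2 : ℕ) * _root_.deriv (_root_.deriv F) y) (_root_.deriv F)
        (closure (Set.Ioi 0)) := by
      have := hc2.continuous
      have := hc3.continuous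
      exact Set.EqOn.closure hpos (by fun_prop) hF.contDiff_deriv.continuous
    rw [closure_Ioi] at hcl
    exact fun y hy => hcl hy

end IsRadialProfile

/-! ### The explicit solution in a ball and its mean. -/

section Ball

variable {d : ℕ} {F : ℝ → ℝ}

/-- The solution of `s² W - Δ W = 1` in the ball of radius `R` about `a`, with `W = 0` on the
boundary. -/
noncomputable def ballSolution (F : ℝ → ℝ) (a : EuclideanSpace ℝ (Fin d)) (R s : ℝ)
    (x : EuclideanSpace ℝ (Fin d)) : ℝ :=
  (1 - F (s ^ 2 * ‖x - a‖ ^ 2) / F ((R * s) ^ 2)) / s ^ 2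

theorem contDiff_ballSolution (hF : IsRadialProfile d F) (a : EuclideanSpace ℝ (Fin d))
    (R s : ℝ) : ContDiff ℝ ∞ (ballSolution F a R s) := by
  have h1 : ContDiff ℝ ∞ fun x : EuclideanSpace ℝ (Fin d) => s ^ 2 * ‖x - a‖ ^ 2 :=
    contDiff_const.mul ((contDiff_id.sub contDiff_const).norm_sq ℝ)
  exact (contDiff_const.sub ((hF.contDiff.comp h1).div_const _)).div_const _

theorem ballSolution_pos (hF : IsRadialProfile d F) (hd : 0 < d)
    {a : EuclideanSpace ℝ (Fin d)} {R s : ℝ}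
    (hR : 0 < R) (hs : 0 < s) {x : EuclideanSpace ℝ (Fin d)} (hx : x ∈ Metric.ball a R) :
    0 < ballSolution F a R s x := by
  have h0 : 0 < F ((R * s) ^ 2) := hF.pos _ (by positivity)
  have h1 : ‖x - a‖ < R := by rwa [← dist_eq_norm]
  have h2 : F (s ^ 2 * ‖x - a‖ ^ 2) < F ((R * s) ^ 2) := by
    refine (hF.strictMonoOn hd) (by simp; positivity) (by simp; positivity) ?_
    rw [mul_pow, mul_comm]
    gcongr
  have h3 : F (s ^ 2 * ‖x - a‖ ^ 2) / F ((R * s) ^ 2) < 1 := (div_lt_one h0).mpr h2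
  exact div_pos (by linarith) (by positivity)

theorem ballSolution_nonpos (hF : IsRadialProfile d F) (hd : 0 < d)
    {a : EuclideanSpace ℝ (Fin d)} {R s : ℝ}
    (hR : 0 < R) (hs : 0 < s) {x : EuclideanSpace ℝ (Fin d)} (hx : x ∉ Metric.ball a R) :
    ballSolution F a R s x ≤ 0 := by
  have h0 : 0 < F ((R * s) ^ 2) := hF.pos _ (by positivity)
  have h1 : R ≤ ‖x - a‖ := by
    rw [Metric.mem_ball, not_lt] at hx
    rwa [← dist_eq_norm]
  have h2 : F ((R * s) ^ 2) ≤ F (s ^ 2 * ‖x - a‖ ^ 2) := by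
    refine (hF.strictMonoOn hd).monotoneOn (by simp; positivity) (by simp; positivity) ?_
    rw [mul_pow, mul_comm]
    gcongr
  have h3 : 1 ≤ F (s ^ 2 * ‖x - a‖ ^ 2) / F ((R * s) ^ 2) := (one_le_div h0).mpr h2
  exact div_nonpos_of_nonpos_of_nonneg (by linarith) (by positivity)

theorem hasFDerivAt_comp_norm_sq {G : ℝ → ℝ} {G' s : ℝ} {a x : EuclideanSpace ℝ (Fin d)}
    (hG : HasDerivAt G G' (s ^ 2 * ‖x - a‖ ^ 2)) :
    HasFDerivAt (fun y => G (s ^ 2 * ‖y - a‖ ^ 2))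
      (G' • (s ^ 2 • (2 : ℝ) • innerSL ℝ (x - a))) x := by
  have h1 : HasFDerivAt (fun y => ‖y - a‖ ^ 2) ((2 : ℝ) • innerSL ℝ (x - a)) x := by
    have := ((hasFDerivAt_id x).sub_const a).norm_sq
    refine this.congr_fderiv ?_
    ext v
    simp
  exact HasDerivAt.comp_hasFDerivAt (h₂ := G) (f := fun y => s ^ 2 * ‖y - a‖ ^ 2) x hG
    (h1.const_mul (s ^ 2))

theorem fderiv_ballSolution (hF : IsRadialProfile d F) (a : EuclideanSpace ℝ (Fin d)) (R : ℝ)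
    {s : ℝ} (hs : 0 < s) (x v : EuclideanSpace ℝ (Fin d)) :
    fderiv ℝ (ballSolution F a R s) x v
      = -(2 / F ((R * s) ^ 2)) * (deriv F (s ^ 2 * ‖x - a‖ ^ 2) * inner ℝ v (x - a)) := by
  have h1 := hasFDerivAt_comp_norm_sq (hF.hasDerivAt (s ^ 2 * ‖x - a‖ ^ 2))
  have h2 := (((h1.mul_const (F ((R * s) ^ 2))⁻¹).const_sub 1).mul_const (s ^ 2)⁻¹).fderiv
  have h3 := congrArg (fun L => L v) h2
  refine Eq.trans h3 ?_
  simp only [smul_apply, neg_apply, innerSL_apply_apply, smul_eq_mul, real_inner_comm v]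
  field_simp

theorem fderiv_fderiv_ballSolution (hF : IsRadialProfile d F) (a : EuclideanSpace ℝ (Fin d))
    (R : ℝ) {s : ℝ} (hs : 0 < s) (x v : EuclideanSpace ℝ (Fin d)) :
    fderiv ℝ (fun y => fderiv ℝ (ballSolution F a R s) y v) x v
      = -(2 / F ((R * s) ^ 2)) * (deriv (deriv F) (s ^ 2 * ‖x - a‖ ^ 2) * (2 * s ^ 2) *
          (inner ℝ v (x - a)) ^ 2 + deriv F (s ^ 2 * ‖x - a‖ ^ 2) * ‖v‖ ^ 2) := by
  simp_rw [fderiv_ballSolution hF a R hs]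
  have h1 := hasFDerivAt_comp_norm_sq (hF.hasDerivAt_deriv (s ^ 2 * ‖x - a‖ ^ 2))
  have h2 : HasFDerivAt (fun y => inner ℝ v (y - a)) (innerSL ℝ v) x := by
    have := (innerSL ℝ v).hasFDerivAt.comp x ((hasFDerivAt_id x).sub_const a)
    exact this
  have h3 := congrArg (fun L => L v) ((h1.mul h2).const_mul (-(2 / F ((R * s) ^ 2)))).fderiv
  refine Eq.trans h3 ?_
  simp only [smul_apply, add_apply, innerSL_apply_apply, smul_eq_mul, real_inner_comm v,
    real_inner_self_eq_norm_sq]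
  ring

/-- Summing the second derivatives over the coordinate directions produces `4yF'' + 2dF'` at `y =
s²‖x - a‖²`, which `ode` replaces by `F`. The right-hand side is in the form required by the
resolvent at `1`. -/
theorem laplacian_ballSolution (hF : IsRadialProfile d F) (a : EuclideanSpace ℝ (Fin d))
    {R s : ℝ} (hs : 0 < s) (x : EuclideanSpace ℝ (Fin d)) :
    ballSolution F a R s x - ∑ i : Fin d, fderiv ℝ (fun y => fderiv ℝ (ballSolution F a R s) y
      (EuclideanSpace.single i 1)) x (EuclideanSpace.single i 1)
      = 1 - (s ^ 2 - 1) * ballSolution F a R s x := by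
  simp_rw [fderiv_fderiv_ballSolution hF a R hs]
  rw [← Finset.mul_sum, Finset.sum_add_distrib, ← Finset.mul_sum]
  have h1 : ∑ i : Fin d, (inner ℝ (EuclideanSpace.single i (1 : ℝ)) (x - a)) ^ 2
      = ‖x - a‖ ^ 2 := by
    rw [EuclideanSpace.real_norm_sq_eq]
    simp [EuclideanSpace.inner_single_left]
  rw [h1]
  have h2 := hF.ode (s ^ 2 * ‖x - a‖ ^ 2) (by positivity)
  simp only [PiLp.norm_single, norm_one, one_pow, mul_one, Finset.sum_const,
    Finset.card_univ, Fintype.card_fin, nsmul_eq_mul]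
  have h3 : -(2 / F ((R * s) ^ 2)) * (deriv (deriv F) (s ^ 2 * ‖x - a‖ ^ 2) * (2 * s ^ 2) *
      ‖x - a‖ ^ 2 + d * deriv F (s ^ 2 * ‖x - a‖ ^ 2))
      = - (F (s ^ 2 * ‖x - a‖ ^ 2) / F ((R * s) ^ 2)) := by
    rw [← h2]; ring
  rw [h3, ballSolution]
  field_simp
  ring

theorem laplaceHeatContent_ball_eq_integral (hF : IsRadialProfile d F) (hd : 0 < d)
    (a : EuclideanSpace ℝ (Fin d)) {R s : ℝ} (hR : 0 < R) (hs : 0 < s) :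
    laplaceHeatContent (Metric.ball a R) s
      = (1 / volume.real (Metric.ball a R)) * ∫ x in Metric.ball a R, ballSolution F a R s x := by
  have hm : MeasurableSet (Metric.ball a R) := measurableSet_ball
  have hb : Bornology.IsBounded (Metric.ball a R) := Metric.isBounded_ball
  have hW := contDiff_ballSolution hF a R s
  have hmem : MemLp (fun x => (ballSolution F a R s x : ℂ)) 2
      (volume.restrict (Metric.ball a R)) :=
    memLp_restrict_of_continuous hm hb (Complex.continuous_ofReal.comp hW.continuous)
  have hw := hmem.coeFn_toLp
  rw [laplaceHeatContent_eq (Metric.ball a R) hs (w := hmem.toLp _)]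
  · congr 1
    refine integral_congr_ae ?_
    filter_upwards [hw] with x hx
    rw [hx, Complex.ofReal_re]
  · refine dirichletResolvent_eq_of_classical hm hb hW (fun x hx => ballSolution_pos hF hd hR hs hx)
      (fun x hx => ballSolution_nonpos hF hd hR hs hx) (laplacian_ballSolution hF a hs) ?_ hw
    filter_upwards [hw, Lp.coeFn_const (p := 2) (μ := volume.restrict (Metric.ball a R)) (1 : ℂ),
      Lp.coeFn_sub (Lp.const 2 (volume.restrict (Metric.ball a R)) (1 : ℂ))
        (((s ^ 2 - 1 : ℝ) : ℂ) • hmem.toLp _),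
      Lp.coeFn_smul ((s ^ 2 - 1 : ℝ) : ℂ) (hmem.toLp _)] with x h1 h2 h3 h4
    rw [h3, Pi.sub_apply, h2, h4, Pi.smul_apply, h1]
    simp

/-- Polar coordinates; `d` times the volume of the unit ball is the area of the unit sphere. -/
theorem setIntegral_ball_comp_norm (hd : 0 < d) (f : ℝ → ℝ) (a : EuclideanSpace ℝ (Fin d))
    {R : ℝ} (hR : 0 < R) :
    ∫ x in Metric.ball a R, f ‖x - a‖
      = d * volume.real (Metric.ball (0 : EuclideanSpace ℝ (Fin d)) 1) *
        ∫ y in (0 : ℝ)..R, y ^ (d - 1) * f y := by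
  have : Nonempty (Fin d) := ⟨⟨0, hd⟩⟩
  have h1 : ∫ x in Metric.ball a R, f ‖x - a‖
      = ∫ x : EuclideanSpace ℝ (Fin d), (Set.Iio R).indicator f ‖x - a‖ := by
    rw [← integral_indicator measurableSet_ball]
    refine integral_congr_ae (Eventually.of_forall fun x => ?_)
    simp [Set.indicator, dist_eq_norm]
  rw [h1, integral_sub_right_eq_self (fun x => (Set.Iio R).indicator f ‖x‖) a,
    integral_fun_norm_addHaar, finrank_euclideanSpace_fin, nsmul_eq_mul, smul_eq_mul, mul_assoc]
  congr 2
  rw [intervalIntegral.integral_of_le hR.le, integral_Ioc_eq_integral_Ioo,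
    ← integral_indicator measurableSet_Ioi, ← integral_indicator measurableSet_Ioo]
  refine integral_congr_ae (Eventually.of_forall fun y => ?_)
  by_cases h0 : 0 < y <;> by_cases hR : y < R <;> simp [Set.indicator_apply, h0, hR]

/-- The Laplace transform of the heat content of a ball in terms of the radial solution. -/
theorem laplaceHeatContent_ball (hF : IsRadialProfile d F) (hd : 0 < d)
    (a : EuclideanSpace ℝ (Fin d)) {R s : ℝ} (hR : 0 < R) (hs : 0 < s) :
    laplaceHeatContent (Metric.ball a R) s
      = 1 / s ^ 2 * (1 - 2 * d * deriv F ((R * s) ^ 2) / F ((R * s) ^ 2)) := by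
  rw [laplaceHeatContent_ball_eq_integral hF hd a hR hs]
  have hvol : volume.real (Metric.ball a R)
      = R ^ d * volume.real (Metric.ball (0 : EuclideanSpace ℝ (Fin d)) 1) := by
    rw [measureReal_def, Measure.addHaar_ball_of_pos _ _ hR, ENNReal.toReal_mul,
      ENNReal.toReal_ofReal (by positivity), finrank_euclideanSpace_fin, measureReal_def]
  have hone : 0 < volume.real (Metric.ball (0 : EuclideanSpace ℝ (Fin d)) 1) :=
    ENNReal.toReal_pos (Metric.measure_ball_pos _ _ one_pos).ne' measure_ball_lt_top.ne
  have hF0 : 0 < F ((R * s) ^ 2) := hF.pos _ (by positivity)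
  have hint : IntegrableOn (fun x => F (s ^ 2 * ‖x - a‖ ^ 2)) (Metric.ball a R) := by
    have := hF.contDiff.continuous
    have hc : Continuous fun x : EuclideanSpace ℝ (Fin d) => F (s ^ 2 * ‖x - a‖ ^ 2) := by fun_prop
    exact (hc.continuousOn.integrableOn_compact (isCompact_closedBall a R)).mono_set
      Metric.ball_subset_closedBall
  simp_rw [ballSolution]
  rw [integral_div, integral_sub (integrable_const _) (hint.div_const _), integral_div,
    setIntegral_ball_comp_norm hd (fun r => F (s ^ 2 * r ^ 2)) a hR,
    hF.intervalIntegral_eq hd, setIntegral_const, hvol]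
  simp only [smul_eq_mul]
  have hRd : 0 < R ^ d := by positivity
  field_simp

end Ball

/-! ### The profiles in dimensions 1, 3 and 5. -/

/-- The entire function `y ↦ cosh √y`. -/
noncomputable def coshSqrt : ℝ → ℝ :=
  FormalMultilinearSeries.ofScalarsSum (E := ℝ) fun n => ((2 * n).factorial : ℝ)⁻¹

/-- The power series has infinite radius of convergence, so smoothness holds across `y = 0`, the
centre of the ball, where `√y` itself is not smooth. -/
theorem contDiff_coshSqrt : ContDiff ℝ ∞ coshSqrt := by
  have hr : (FormalMultilinearSeries.ofScalars ℝ fun n => ((2 * n).factorial : ℝ)⁻¹).radius = ⊤ := by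
    refine FormalMultilinearSeries.ofScalars_radius_eq_top_of_tendsto ℝ _
      (Eventually.of_forall fun n => by positivity) ?_
    have h1 : ∀ n : ℕ, ‖((2 * n.succ).factorial : ℝ)⁻¹‖ / ‖((2 * n).factorial : ℝ)⁻¹‖
        = ((2 * (n : ℝ) + 2) * (2 * n + 1))⁻¹ := by
      intro n
      have h2 : (2 * n.succ).factorial = (2 * n + 2) * ((2 * n + 1) * (2 * n).factorial) := rfl
      have h3 : ((2 * n).factorial : ℝ) ≠ 0 := by positivity
      rw [h2, Real.norm_of_nonneg (by positivity), Real.norm_of_nonneg (by positivity)]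
      push_cast
      field_simp
    simp_rw [h1]
    refine squeeze_zero (fun n => by positivity) (fun n => ?_)
      tendsto_one_div_add_atTop_nhds_zero_nat
    rw [← one_div]
    exact one_div_le_one_div_of_le (by positivity) (by nlinarith [n.cast_nonneg (α := ℝ)])
  have h := FormalMultilinearSeries.hasFPowerSeriesOnBall
    (FormalMultilinearSeries.ofScalars ℝ fun n => ((2 * n).factorial : ℝ)⁻¹) (by rw [hr]; simp)
  have h2 : AnalyticOnNhd ℝ coshSqrt Set.univ := by
    have := h.analyticOnNhd
    rw [hr] at this
    simp only [Metric.eball_top] at this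
    exact this
  exact contDiffOn_univ.mp (h2.contDiffOn uniqueDiffOn_univ)

theorem coshSqrt_sq (r : ℝ) : coshSqrt (r ^ 2) = Real.cosh r := by
  rw [← (Real.hasSum_cosh r).tsum_eq, coshSqrt, FormalMultilinearSeries.ofScalars_sum_eq]
  refine tsum_congr fun n => ?_
  rw [smul_eq_mul, pow_mul, div_eq_inv_mul]

theorem deriv_coshSqrt_sq (r : ℝ) : 2 * r * deriv coshSqrt (r ^ 2) = Real.sinh r := by
  have h1 : HasDerivAt (fun r : ℝ => coshSqrt (r ^ 2)) (deriv coshSqrt (r ^ 2) * (2 * r)) r := by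
    have := (contDiff_coshSqrt.differentiable (by simp) (r ^ 2)).hasDerivAt.comp r
      (hasDerivAt_pow 2 r)
    exact this.congr_deriv (by simp)
  simp_rw [coshSqrt_sq] at h1
  rw [← h1.unique (Real.hasDerivAt_cosh r)]
  ring

/-- Differentiating `2r F'(r²) = sinh r` gives `2F' + 4r²F'' = cosh r`, the equation for `d = 1` at
`y = r²`. -/
theorem isRadialProfile_coshSqrt : IsRadialProfile 1 coshSqrt where
  contDiff := contDiff_coshSqrt
  pos y hy := by
    rw [← Real.sq_sqrt hy.le, coshSqrt_sq]
    exact Real.cosh_pos _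
  ode y hy := by
    obtain ⟨r, rfl⟩ : ∃ r, r ^ 2 = y := ⟨√y, Real.sq_sqrt hy⟩
    have h1 : HasDerivAt (fun r : ℝ => 2 * r * deriv coshSqrt (r ^ 2))
        (2 * deriv coshSqrt (r ^ 2) + 2 * r * (deriv (deriv coshSqrt) (r ^ 2) * (2 * r))) r := by
      have hd := (contDiff_infty_iff_deriv.mp contDiff_coshSqrt).2
      have h2 := (hd.differentiable (by simp) (r ^ 2)).hasDerivAt.comp r (hasDerivAt_pow 2 r)
      exact (((hasDerivAt_id r).const_mul 2).mul h2).congr_deriv (by simp)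
    simp_rw [deriv_coshSqrt_sq] at h1
    rw [coshSqrt_sq, ← h1.unique (Real.hasDerivAt_sinh r)]
    push_cast
    ring

theorem deriv_coshSqrt_sq_eq {u : ℝ} (hu : u ≠ 0) :
    deriv coshSqrt (u ^ 2) = Real.sinh u / (2 * u) := by
  rw [← deriv_coshSqrt_sq]
  field_simp

theorem deriv_deriv_coshSqrt_sq_eq {u : ℝ} (hu : u ≠ 0) :
    deriv (deriv coshSqrt) (u ^ 2) = (u * Real.cosh u - Real.sinh u) / (4 * u ^ 3) := by
  have h := isRadialProfile_coshSqrt.ode (u ^ 2) (by positivity)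
  rw [coshSqrt_sq, deriv_coshSqrt_sq_eq hu] at h
  push_cast at h
  rw [← h]
  field_simp
  ring

/-- Solved algebraically from the equation in dimension 3, `4u²F''' + 6F'' = F'`, with no further
differentiation. -/
theorem deriv_deriv_deriv_coshSqrt_sq_eq {u : ℝ} (hu : u ≠ 0) :
    deriv (deriv (deriv coshSqrt)) (u ^ 2)
      = ((3 + u ^ 2) * Real.sinh u - 3 * u * Real.cosh u) / (8 * u ^ 5) := by
  have h := (isRadialProfile_coshSqrt.deriv one_pos).ode (u ^ 2) (by positivity)
  rw [deriv_coshSqrt_sq_eq hu, deriv_deriv_coshSqrt_sq_eq hu] at h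
  push_cast at h
  field_simp at h ⊢
  linarith

theorem laplaceHeatContent_ball_one (a : EuclideanSpace ℝ (Fin 1)) {R s : ℝ} (hR : 0 < R)
    (hs : 0 < s) : laplaceHeatContent (Metric.ball a R) s
      = 1 / s ^ 2 * (1 - Real.tanh (R * s) / (R * s)) := by
  have hu : R * s ≠ 0 := by positivity
  rw [laplaceHeatContent_ball isRadialProfile_coshSqrt one_pos a hR hs, coshSqrt_sq,
    deriv_coshSqrt_sq_eq hu, Real.tanh_eq_sinh_div_cosh]
  have := (Real.cosh_pos (R * s)).ne'
  push_cast
  field_simp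

theorem laplaceHeatContent_ball_three (a : EuclideanSpace ℝ (Fin 3)) {R s : ℝ} (hR : 0 < R)
    (hs : 0 < s) : laplaceHeatContent (Metric.ball a R) s
      = 1 / s ^ 2 * (1 - 3 * (R * s - Real.tanh (R * s)) / ((R * s) ^ 2 * Real.tanh (R * s))) := by
  have hu : 0 < R * s := by positivity
  rw [laplaceHeatContent_ball (isRadialProfile_coshSqrt.deriv one_pos) (by norm_num) a hR hs,
    deriv_coshSqrt_sq_eq hu.ne', deriv_deriv_coshSqrt_sq_eq hu.ne', Real.tanh_eq_sinh_div_cosh]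
  have h1 := (Real.cosh_pos (R * s)).ne'
  have h2 := (Real.sinh_pos_iff.mpr hu).ne'
  generalize R * s = u at *
  push_cast
  field_simp
  ring

theorem laplaceHeatContent_ball_five (a : EuclideanSpace ℝ (Fin 5)) {R s : ℝ} (hR : 0 < R)
    (hs : 0 < s) (hu1 : 1 < R * s) : laplaceHeatContent (Metric.ball a R) s
      = 1 / s ^ 2 * (1 - 5 * ((3 + (R * s) ^ 2) * Real.tanh (R * s) - 3 * (R * s)) /
          ((R * s) ^ 2 * (R * s - Real.tanh (R * s)))) := by
  have hu : 0 < R * s := by positivity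
  rw [laplaceHeatContent_ball ((isRadialProfile_coshSqrt.deriv one_pos).deriv (by norm_num))
    (by norm_num) a hR hs, deriv_deriv_coshSqrt_sq_eq hu.ne',
    deriv_deriv_deriv_coshSqrt_sq_eq hu.ne', Real.tanh_eq_sinh_div_cosh]
  have h1 := Real.cosh_pos (R * s)
  -- For `u > 1`, `u cosh u > cosh u > sinh u`.
  have h2 : 0 < R * s * Real.cosh (R * s) - Real.sinh (R * s) := by
    nlinarith [Real.sinh_lt_cosh (R * s)]
  have h4 : R * s - Real.sinh (R * s) / Real.cosh (R * s)
      = (R * s * Real.cosh (R * s) - Real.sinh (R * s)) / Real.cosh (R * s) := by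
    field_simp
  rw [h4]
  generalize R * s = u at *
  have h3 := h2.ne'
  push_cast
  field_simp
  ring

/-! ### Exponentially small terms and powers of `1/s`. -/

section Asymptotics

theorem one_sub_tanh_nonneg (u : ℝ) : 0 ≤ 1 - Real.tanh u := by
  rw [Real.tanh_eq_sinh_div_cosh, sub_nonneg, div_le_one (Real.cosh_pos u)]
  exact (Real.sinh_lt_cosh u).le

/-- The difference is `e^{-u}/cosh u`, and `cosh u ≥ e^u/2`. -/
theorem one_sub_tanh_le (u : ℝ) : 1 - Real.tanh u ≤ 2 * Real.exp (-2 * u) := by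
  have h1 := Real.cosh_pos u
  have h2 : 1 - Real.tanh u = Real.exp (-u) / Real.cosh u := by
    rw [Real.tanh_eq_sinh_div_cosh, ← Real.cosh_sub_sinh]
    field_simp
  have h3 : Real.exp (-2 * u) = Real.exp (-u) * Real.exp (-u) := by
    rw [← Real.exp_add]; ring_nf
  have h4 : Real.exp u / 2 ≤ Real.cosh u := by
    rw [Real.cosh_eq]; linarith [Real.exp_pos (-u)]
  have h5 : Real.exp u * Real.exp (-u) = 1 := by rw [← Real.exp_add]; simp
  rw [h2, h3, div_le_iff₀ h1]
  nlinarith [mul_le_mul_of_nonneg_left h4 (mul_pos (Real.exp_pos (-u)) (Real.exp_pos (-u))).le,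
    Real.exp_pos (-u)]

theorem half_le_tanh {u : ℝ} (hu : 2 ≤ u) : 1 / 2 ≤ Real.tanh u := by
  have h1 := one_sub_tanh_le u
  have h2 : Real.exp (-2 * u) * Real.exp (2 * u) = 1 := by rw [← Real.exp_add]; simp
  have h3 := Real.add_one_le_exp (2 * u)
  have h4 : Real.exp (-2 * u) * 4 ≤ 1 := by
    rw [← h2]
    exact mul_le_mul_of_nonneg_left (by linarith) (Real.exp_pos _).le
  linarith

theorem exponentiallySmall_of_le {f : ℝ → ℝ} {R K : ℝ} (hR : 0 < R)
    (h : ∀ᶠ s in atTop, |f s| ≤ K * (1 - Real.tanh (R * s))) : ExponentiallySmall f := by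
  refine ⟨2 * R, by positivity, IsBigO.of_bound (2 * |K|) ?_⟩
  filter_upwards [h] with s hs
  rw [Real.norm_eq_abs, Real.norm_of_nonneg (Real.exp_nonneg _)]
  calc |f s| ≤ K * (1 - Real.tanh (R * s)) := hs
    _ ≤ |K| * (1 - Real.tanh (R * s)) :=
        mul_le_mul_of_nonneg_right (le_abs_self K) (one_sub_tanh_nonneg _)
    _ ≤ |K| * (2 * Real.exp (-2 * (R * s))) :=
        mul_le_mul_of_nonneg_left (one_sub_tanh_le _) (abs_nonneg K)
    _ = 2 * |K| * Real.exp (-(2 * R) * s) := by ring_nf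

theorem ExponentiallySmall.isLittleO {f : ℝ → ℝ} (hf : ExponentiallySmall f) (N : ℕ) :
    f =o[atTop] fun s => 1 / s ^ N := by
  obtain ⟨κ, hκ, h⟩ := hf
  refine h.trans_isLittleO ((isLittleO_exp_neg_mul_rpow_atTop hκ (-(N : ℝ))).congr'
    EventuallyEq.rfl ?_)
  filter_upwards [eventually_gt_atTop 0] with s hs
  rw [Real.rpow_neg hs.le, Real.rpow_natCast, one_div]

theorem isLittleO_one_div_pow_succ (N : ℕ) :
    (fun s : ℝ => 1 / s ^ (N + 1)) =o[atTop] fun s => 1 / s ^ N := by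
  have h := (isLittleO_const_id_atTop (1 : ℝ)).inv_rev (by simp)
  have h2 := h.mul_isBigO (isBigO_refl (fun s : ℝ => 1 / s ^ N) atTop)
  refine h2.congr (fun s => ?_) fun s => by simp
  simp only [id, pow_succ]
  field_simp

end Asymptotics

/-! ### Uniqueness and construction of Weyl series. -/

section WeylSeries

variable {f g : ℝ → ℝ} {c c' : ℕ → ℝ}

/-- Once the earlier coefficients agree, the difference of the two remainders is `(c n - c' n)/s^n`,
which is `o(s^{-n})` only if the coefficients are equal. -/
theorem HasWeylSeries.unique (h : HasWeylSeries f c) (h' : HasWeylSeries f c') :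
    ∀ n, 2 ≤ n → c n = c' n := by
  intro n
  induction n using Nat.strong_induction_on with
  | _ n ih =>
    intro hn
    obtain ⟨m, rfl⟩ : ∃ m, n = m + 1 := ⟨n - 1, by omega⟩
    have h1 := (h' _ hn).sub (h _ hn)
    have hsum : ∀ s : ℝ, ∑ k ∈ Finset.Icc 2 m, c k / s ^ k = ∑ k ∈ Finset.Icc 2 m, c' k / s ^ k :=
      fun s => Finset.sum_congr rfl fun k hk => by
        rw [Finset.mem_Icc] at hk
        rw [ih k (by omega) hk.1]
    have h2 : (fun s : ℝ => (c (m + 1) - c' (m + 1)) * (1 / s ^ (m + 1)))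
        =o[atTop] fun s => 1 / s ^ (m + 1) := by
      refine h1.congr_left fun s => ?_
      rw [Finset.sum_Icc_succ_top hn, Finset.sum_Icc_succ_top hn, hsum]
      ring
    by_contra hne
    have h3 := (isLittleO_const_mul_left_iff (sub_ne_zero.mpr hne)).mp h2
    refine isLittleO_irrefl (Eventually.frequently ?_) h3
    filter_upwards [eventually_gt_atTop 0] with s hs
    positivity

/-- Descent in `N`: the estimate at order `N + 1` implies the one at order `N`, because the term
removed from the sum is itself `o(s^{-N})`. -/
theorem hasWeylSeries_of_eventually {N₀ : ℕ}
    (h : ∀ N, N₀ ≤ N →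
      (fun s => f s - ∑ n ∈ Finset.Icc 2 N, c n / s ^ n) =o[atTop] fun s => 1 / s ^ N) :
    HasWeylSeries f c := by
  have key : ∀ k N, 2 ≤ N → N₀ ≤ N + k →
      (fun s => f s - ∑ n ∈ Finset.Icc 2 N, c n / s ^ n) =o[atTop] fun s => 1 / s ^ N := by
    intro k
    induction k with
    | zero => exact fun N _ hk => h N hk
    | succ k ih =>
      intro N hN hk
      have h1 := (ih (N + 1) (by omega) (by omega)).trans (isLittleO_one_div_pow_succ N)
      have h2 := h1.add ((isLittleO_one_div_pow_succ N).const_mul_left (c (N + 1)))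
      refine h2.congr_left fun s => ?_
      rw [Finset.sum_Icc_succ_top (by omega)]
      ring
  exact fun N hN => key N₀ N hN (by omega)

theorem hasWeylSeries_of_exponentiallySmall (hfg : ExponentiallySmall fun s => f s - g s) {N₀ : ℕ}
    {K : ℕ → ℝ}
    (h : ∀ N, N₀ ≤ N → ∀ᶠ s in atTop,
      |g s - ∑ n ∈ Finset.Icc 2 N, c n / s ^ n| ≤ K N * |1 / s ^ (N + 1)|) :
    HasWeylSeries f c := by
  refine hasWeylSeries_of_eventually (N₀ := N₀) fun N hN => ?_
  have h0 : (fun s => g s - ∑ n ∈ Finset.Icc 2 N, c n / s ^ n) =O[atTop]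
      fun s => 1 / s ^ (N + 1) := IsBigO.of_bound (K N) (h N hN)
  have h1 := h0.trans_isLittleO (isLittleO_one_div_pow_succ N)
  refine ((hfg.isLittleO N).add h1).congr_left fun s => ?_
  ring

end WeylSeries

/-! ### The three dimensions. -/

section Ball

variable {R : ℝ}

theorem exponentiallySmall_ball_one (hR : 0 < R) (a : EuclideanSpace ℝ (Fin 1)) :
    ExponentiallySmall fun s => laplaceHeatContent (Metric.ball a R) s
      - 1 / s ^ 2 * (1 - 1 / (R * s)) := by
  refine exponentiallySmall_of_le (K := 1) hR ?_
  filter_upwards [eventually_ge_atTop 1, eventually_ge_atTop (1 / R)] with s hs hsR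
  have hs0 : 0 < s := by linarith
  have hu : 1 ≤ R * s := by rwa [div_le_iff₀' hR] at hsR
  have ht := one_sub_tanh_nonneg (R * s)
  rw [laplaceHeatContent_ball_one a hR hs0]
  have h1 : 1 / s ^ 2 * (1 - Real.tanh (R * s) / (R * s)) - 1 / s ^ 2 * (1 - 1 / (R * s))
      = (1 - Real.tanh (R * s)) / (s ^ 2 * (R * s)) := by
    field_simp
    ring
  rw [h1, abs_of_nonneg (by positivity), one_mul]
  exact div_le_self ht (one_le_mul_of_one_le_of_one_le (one_le_pow₀ hs) hu)

theorem exponentiallySmall_ball_three (hR : 0 < R) (a : EuclideanSpace ℝ (Fin 3)) :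
    ExponentiallySmall fun s => laplaceHeatContent (Metric.ball a R) s
      - 1 / s ^ 2 * (1 - 3 / (R * s) + 3 / (R * s) ^ 2) := by
  refine exponentiallySmall_of_le (K := 6) hR ?_
  filter_upwards [eventually_ge_atTop 1, eventually_ge_atTop (2 / R)] with s hs hsR
  have hs0 : 0 < s := by linarith
  have hu : 2 ≤ R * s := by rwa [div_le_iff₀' hR] at hsR
  have ht := one_sub_tanh_nonneg (R * s)
  have ht2 := half_le_tanh hu
  rw [laplaceHeatContent_ball_three a hR hs0]
  generalize Real.tanh (R * s) = t at *
  have ht0 : 0 < t := by linarith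
  have h1 : 1 / s ^ 2 * (1 - 3 * (R * s - t) / ((R * s) ^ 2 * t))
      - 1 / s ^ 2 * (1 - 3 / (R * s) + 3 / (R * s) ^ 2)
      = - (3 * (1 - t) / (s ^ 2 * (R * s) * t)) := by
    field_simp
    ring
  rw [h1, abs_neg, abs_of_nonneg (by positivity), div_le_iff₀ (by positivity)]
  have h2 : 1 ≤ s ^ 2 * (R * s) :=
    one_le_mul_of_one_le_of_one_le (one_le_pow₀ hs) (by linarith)
  -- Together with the numerator `3(1 - t)` this gives the constant `K = 6`.
  have h3 : 1 / 2 ≤ s ^ 2 * (R * s) * t := by nlinarith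
  nlinarith

theorem exponentiallySmall_ball_five (hR : 0 < R) (a : EuclideanSpace ℝ (Fin 5)) :
    ExponentiallySmall fun s => laplaceHeatContent (Metric.ball a R) s
      - 1 / s ^ 2 * ((1 - 6 / (R * s) + 15 / (R * s) ^ 2 - 15 / (R * s) ^ 3)
        / (1 - 1 / (R * s))) := by
  refine exponentiallySmall_of_le (K := 10) hR ?_
  filter_upwards [eventually_ge_atTop 1, eventually_ge_atTop (2 / R)] with s hs hsR
  have hs0 : 0 < s := by linarith
  have hu : 2 ≤ R * s := by rwa [div_le_iff₀' hR] at hsR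
  have ht := one_sub_tanh_nonneg (R * s)
  rw [laplaceHeatContent_ball_five a hR hs0 (by linarith)]
  generalize Real.tanh (R * s) = t at *
  generalize R * s = u at *
  have hut : 0 < u - t := by linarith
  have hu1 : 0 < u - 1 := by linarith
  have hu0 : 0 < u := by linarith
  have h0 : 1 - 1 / u = (u - 1) / u := by field_simp
  have h1 : 1 / s ^ 2 * (1 - 5 * ((3 + u ^ 2) * t - 3 * u) / (u ^ 2 * (u - t)))
      - 1 / s ^ 2 * ((1 - 6 / u + 15 / u ^ 2 - 15 / u ^ 3) / (1 - 1 / u))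
      = 5 * u * (1 - t) / (s ^ 2 * ((u - t) * (u - 1))) := by
    rw [h0]
    field_simp
    ring
  rw [h1, abs_of_nonneg (by positivity), div_le_iff₀ (by positivity)]
  -- Since `t ≤ 1` and `u ≥ 2`, `u - t ≥ u - 1 ≥ u/2` and `u - 1 ≥ 1`. With the numerator `5u(1 -
  -- t)` this yields `K = 10`.
  have h2 : u / 2 ≤ (u - t) * (u - 1) := by nlinarith
  have h3 : u / 2 ≤ s ^ 2 * ((u - t) * (u - 1)) :=
    h2.trans (le_mul_of_one_le_left (by positivity) (one_le_pow₀ hs))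
  nlinarith [mul_le_mul_of_nonneg_left h3 ht]

theorem hasWeylSeries_ball_one (hR : 0 < R) (a : EuclideanSpace ℝ (Fin 1)) (c : ℕ → ℝ) :
    HasWeylSeries (laplaceHeatContent (Metric.ball a R)) c ↔
      c 2 = 1 ∧ c 3 = -1 / R ∧ ∀ n, 3 < n → c n = 0 := by
  have key : ∀ c : ℕ → ℝ, (c 2 = 1 ∧ c 3 = -1 / R ∧ ∀ n, 3 < n → c n = 0) →
      HasWeylSeries (laplaceHeatContent (Metric.ball a R)) c := by
    rintro c ⟨h2, h3, hn⟩
    refine hasWeylSeries_of_exponentiallySmall (exponentiallySmall_ball_one hR a) (N₀ := 3)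
      (K := 0) fun N hN => ?_
    filter_upwards [eventually_gt_atTop 0] with s hs
    have hsum : ∑ n ∈ Finset.Icc 2 N, c n / s ^ n = 1 / s ^ 2 * (1 - 1 / (R * s)) := by
      induction N, hN using Nat.le_induction with
      | base =>
        simp only [Finset.sum_Icc_succ_top (show 2 ≤ 3 by norm_num), Finset.Icc_self,
          Finset.sum_singleton, h2, h3]
        field_simp
        ring
      | succ N hN ih =>
        rw [Finset.sum_Icc_succ_top (by omega), ih, hn (N + 1) (by omega), zero_div, add_zero]
    simp [hsum]
  refine ⟨fun h => ?_, key c⟩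
  -- One explicit sequence with these values has the Weyl property; uniqueness transfers the values
  -- to `c`.
  have h0 := key (fun n => if n = 2 then 1 else if n = 3 then -1 / R else 0)
    ⟨by simp, by simp, fun n hn => by simp [show n ≠ 2 by omega, show n ≠ 3 by omega]⟩
  have hu := h.unique h0
  exact ⟨by simpa using hu 2 le_rfl, by simpa using hu 3 (by omega), fun n hn => by
    simpa [show n ≠ 2 by omega, show n ≠ 3 by omega] using hu n (by omega)⟩

theorem hasWeylSeries_ball_three (hR : 0 < R) (a : EuclideanSpace ℝ (Fin 3)) (c : ℕ → ℝ) :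
    HasWeylSeries (laplaceHeatContent (Metric.ball a R)) c ↔
      c 2 = 1 ∧ c 3 = -3 / R ∧ c 4 = 3 / R ^ 2 ∧ ∀ n, 4 < n → c n = 0 := by
  have key : ∀ c : ℕ → ℝ, (c 2 = 1 ∧ c 3 = -3 / R ∧ c 4 = 3 / R ^ 2 ∧ ∀ n, 4 < n → c n = 0) →
      HasWeylSeries (laplaceHeatContent (Metric.ball a R)) c := by
    rintro c ⟨h2, h3, h4, hn⟩
    refine hasWeylSeries_of_exponentiallySmall (exponentiallySmall_ball_three hR a) (N₀ := 4)
      (K := 0) fun N hN => ?_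
    filter_upwards [eventually_gt_atTop 0] with s hs
    have hsum : ∑ n ∈ Finset.Icc 2 N, c n / s ^ n
        = 1 / s ^ 2 * (1 - 3 / (R * s) + 3 / (R * s) ^ 2) := by
      induction N, hN using Nat.le_induction with
      | base =>
        simp only [Finset.sum_Icc_succ_top (show 2 ≤ 4 by norm_num),
          Finset.sum_Icc_succ_top (show 2 ≤ 3 by norm_num), Finset.Icc_self,
          Finset.sum_singleton, h2, h3, h4]
        field_simp
        ring
      | succ N hN ih =>
        rw [Finset.sum_Icc_succ_top (by omega), ih, hn (N + 1) (by omega), zero_div, add_zero]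
    simp [hsum]
  refine ⟨fun h => ?_, key c⟩
  have h0 := key (fun n => if n = 2 then 1 else if n = 3 then -3 / R else
      if n = 4 then 3 / R ^ 2 else 0)
    ⟨by simp, by simp, by simp, fun n hn => by
      simp [show n ≠ 2 by omega, show n ≠ 3 by omega, show n ≠ 4 by omega]⟩
  have hu := h.unique h0
  exact ⟨by simpa using hu 2 le_rfl, by simpa using hu 3 (by omega),
    by simpa using hu 4 (by omega), fun n hn => by
    simpa [show n ≠ 2 by omega, show n ≠ 3 by omega, show n ≠ 4 by omega] using hu n (by omega)⟩

theorem hasWeylSeries_ball_five (hR : 0 < R) (a : EuclideanSpace ℝ (Fin 5)) (c : ℕ → ℝ) :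
    HasWeylSeries (laplaceHeatContent (Metric.ball a R)) c ↔
      c 2 = 1 ∧ c 3 = -5 / R ∧ c 4 = 10 / R ^ 2 ∧ ∀ n, 5 ≤ n → c n = -5 / R ^ (n - 2) := by
  have key : ∀ c : ℕ → ℝ, (c 2 = 1 ∧ c 3 = -5 / R ∧ c 4 = 10 / R ^ 2 ∧
      ∀ n, 5 ≤ n → c n = -5 / R ^ (n - 2)) →
      HasWeylSeries (laplaceHeatContent (Metric.ball a R)) c := by
    rintro c ⟨h2, h3, h4, hn⟩
    refine hasWeylSeries_of_exponentiallySmall (exponentiallySmall_ball_five hR a) (N₀ := 4)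
      (K := fun N => 10 / R ^ (N - 1)) fun N hN => ?_
    filter_upwards [eventually_gt_atTop 0, eventually_ge_atTop (2 / R)] with s hs hsR
    have hu : 2 ≤ R * s := by rwa [div_le_iff₀' hR] at hsR
    have hu1 : 0 < R * s - 1 := by linarith
    have hne : s * R - 1 ≠ 0 := by rw [mul_comm]; exact hu1.ne'
    have hq : 1 - 1 / (R * s) = (R * s - 1) / (R * s) := by field_simp
    -- The exact remainder is the geometric tail `-5 s⁻² ∑ u^{-k}` over `k > N - 2`. Bounding `u -
    -- 1` below by `u/2` gives the constant `10 / R^(N - 1)`.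
    have hsum : 1 / s ^ 2 * ((1 - 6 / (R * s) + 15 / (R * s) ^ 2 - 15 / (R * s) ^ 3)
        / (1 - 1 / (R * s))) - ∑ n ∈ Finset.Icc 2 N, c n / s ^ n
        = - (5 / (s ^ 2 * (R * s) ^ (N - 2) * (R * s - 1))) := by
      rw [hq]
      induction N, hN using Nat.le_induction with
      | base =>
        simp only [Finset.sum_Icc_succ_top (show 2 ≤ 4 by norm_num),
          Finset.sum_Icc_succ_top (show 2 ≤ 3 by norm_num), Finset.Icc_self,
          Finset.sum_singleton, h2, h3, h4]
        field_simp
        ring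
      | succ N hN ih =>
        rw [Finset.sum_Icc_succ_top (by omega), ← sub_sub, ih, hn (N + 1) (by omega)]
        obtain ⟨m, rfl⟩ : ∃ m, N = m + 2 := ⟨N - 2, by omega⟩
        simp only [Nat.add_sub_cancel, show m + 2 + 1 - 2 = m + 1 by omega, mul_pow]
        field_simp
        ring
    rw [hsum, abs_neg, abs_of_nonneg (by positivity), abs_of_nonneg (by positivity)]
    obtain ⟨m, rfl⟩ : ∃ m, N = m + 2 := ⟨N - 2, by omega⟩
    simp only [Nat.add_sub_cancel, show m + 2 - 1 = m + 1 by omega]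
    have h5 : R * s / 2 ≤ R * s - 1 := by linarith
    calc 5 / (s ^ 2 * (R * s) ^ m * (R * s - 1))
        ≤ 5 / (s ^ 2 * (R * s) ^ m * (R * s / 2)) := by gcongr
      _ = 10 / R ^ (m + 1) * (1 / s ^ (m + 2 + 1)) := by
          field_simp
          ring
  refine ⟨fun h => ?_, key c⟩
  have h0 := key (fun n => if n = 2 then 1 else if n = 3 then -5 / R else
      if n = 4 then 10 / R ^ 2 else -5 / R ^ (n - 2))
    ⟨by simp, by simp, by simp, fun n hn => by
      simp [show n ≠ 2 by omega, show n ≠ 3 by omega, show n ≠ 4 by omega]⟩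
  have hu := h.unique h0
  exact ⟨by simpa using hu 2 le_rfl, by simpa using hu 3 (by omega),
    by simpa using hu 4 (by omega), fun n hn => by
    simpa [show n ≠ 2 by omega, show n ≠ 3 by omega, show n ≠ 4 by omega] using hu n (by omega)⟩

end Ball

theorem hasSum_one_div_pow_add_three {u : ℝ} (hu : 1 < u) :
    HasSum (fun k : ℕ => 1 / u ^ (k + 3)) (1 / u ^ 3 * (1 - 1 / u)⁻¹) := by
  have h := (hasSum_geometric_of_lt_one (r := 1 / u) (by positivity)
    ((div_lt_one (by positivity)).mpr hu)).mul_left (1 / u ^ 3)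
  refine h.congr_fun ?_
  intro k
  rw [pow_add, one_div_pow]
  field_simp

/-- With `v = 1/u`, division gives `1 - 6v + 15v² - 15v³ = (1 - v)(1 - 5v + 10v²) - 5v³`; the last
term yields the geometric series. -/
theorem rational_expansion {u : ℝ} (hu : 1 < u) :
    (1 - 6 / u + 15 / u ^ 2 - 15 / u ^ 3) / (1 - 1 / u)
      = 1 - 5 / u + 10 / u ^ 2 - 5 * ∑' k : ℕ, 1 / u ^ (k + 3) := by
  rw [(hasSum_one_div_pow_add_three hu).tsum_eq]
  have hq : 1 - 1 / u = (u - 1) / u := by field_simp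
  have : 0 < u - 1 := by linarith
  rw [hq]
  field_simp
  ring

end HeatContent

theorem mainTheorem2 (R : ℝ) (hR : 0 < R) :
    -- the Laplace integrals converge
    (∀ d ∈ ({1, 3, 5} : Set ℕ), ∀ a : EuclideanSpace ℝ (Fin d), ∀ s : ℝ, 0 < s →
      MeasureTheory.IntegrableOn
        (fun t => Real.exp (-s ^ 2 * t) * HeatContent.heatContent (Metric.ball a R) t)
        (Set.Ioi 0)) ∧
    -- dimension 1
    (∀ a : EuclideanSpace ℝ (Fin 1),
      HeatContent.ExponentiallySmall (fun s =>
        HeatContent.laplaceHeatContent (Metric.ball a R) s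
          - 1 / s ^ 2 * (1 - 1 / (R * s))) ∧
      ∀ c : ℕ → ℝ,
        HeatContent.HasWeylSeries (HeatContent.laplaceHeatContent (Metric.ball a R)) c ↔
          c 2 = 1 ∧ c 3 = -1 / R ∧ ∀ n, 3 < n → c n = 0) ∧
    -- dimension 3
    (∀ a : EuclideanSpace ℝ (Fin 3),
      HeatContent.ExponentiallySmall (fun s =>
        HeatContent.laplaceHeatContent (Metric.ball a R) s
          - 1 / s ^ 2 * (1 - 3 / (R * s) + 3 / (R * s) ^ 2)) ∧
      ∀ c : ℕ → ℝ,
        HeatContent.HasWeylSeries (HeatContent.laplaceHeatContent (Metric.ball a R)) c ↔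
          c 2 = 1 ∧ c 3 = -3 / R ∧ c 4 = 3 / R ^ 2 ∧ ∀ n, 4 < n → c n = 0) ∧
    -- dimension 5
    (∀ a : EuclideanSpace ℝ (Fin 5),
      HeatContent.ExponentiallySmall (fun s =>
        HeatContent.laplaceHeatContent (Metric.ball a R) s
          - 1 / s ^ 2 *
            ((1 - 6 / (R * s) + 15 / (R * s) ^ 2 - 15 / (R * s) ^ 3) / (1 - 1 / (R * s)))) ∧
      ∀ c : ℕ → ℝ,
        HeatContent.HasWeylSeries (HeatContent.laplaceHeatContent (Metric.ball a R)) c ↔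
          c 2 = 1 ∧ c 3 = -5 / R ∧ c 4 = 10 / R ^ 2 ∧
            ∀ n, 5 ≤ n → c n = -5 / R ^ (n - 2)) ∧
    -- the expansion of the rational function that occurs in dimension 5
    (∀ u : ℝ, 1 < u →
      Summable (fun k : ℕ => 1 / u ^ (k + 3)) ∧
      (1 - 6 / u + 15 / u ^ 2 - 15 / u ^ 3) / (1 - 1 / u)
        = 1 - 5 / u + 10 / u ^ 2 - 5 * ∑' k : ℕ, 1 / u ^ (k + 3)) := by
  refine ⟨fun d _ a s hs => HeatContent.integrableOn_laplace_heatContent _ hs,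
    fun a => ⟨HeatContent.exponentiallySmall_ball_one hR a,
      HeatContent.hasWeylSeries_ball_one hR a⟩,
    fun a => ⟨HeatContent.exponentiallySmall_ball_three hR a,
      HeatContent.hasWeylSeries_ball_three hR a⟩,
    fun a => ⟨HeatContent.exponentiallySmall_ball_five hR a,
      HeatContent.hasWeylSeries_ball_five hR a⟩,
    fun u hu => ⟨(HeatContent.hasSum_one_div_pow_add_three hu).summable,
      HeatContent.rational_expansion hu⟩⟩
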